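/- **Conventions.** All vector spaces are finite-dimensional, real, and carry the Euclidean topology. Let $\lambda$ be a partition of an integer $n\ge 1$, identified with its Young diagram. For a set $X$, elements of $X^{n}$ are written as fillings of the $n$ boxes of $\lambda$ (boxes listed left to right, top to bottom). A map $T$ from $X^n$ to a vector space satisfies the *$\lambda$-exchange axioms* if (i) $T(v)=0$ whenever $v$ has equal entries in two different boxes of one column, and (ii) for any two columns and any set $B$ of boxes of the right one, $T(v)=\sum_{w}T(w)$, where for each set $A$ of $|B|$ boxes in the left column the sum has one term $w$, obtained from $v$ by interchanging the entries in $A$ with those in $B$, keeping the vertical order. Let $h_\lambda:V^{n}\to\mathbb S_\lambda(V)$ be the universal multilinear map satisfying the $\lambda$-exchange axioms, where $\mathbb S_\lambda(V)$ is the quotient of $V^{\otimes n}$ by the corresponding relations; for linear $L:V\to V'$ let $\mathbb S_\lambda(L)$ be the linear map with $\mathbb S_\lambda(L)(h_\lambda(v))=h_\lambda(L\circ v)$. For $P\subseteq V$ put $$\mathbb S_\lambda(P):=\operatorname{Conv}\big(h_\lambda(P\times\cdots\times P)\big)\subseteq \mathbb S_\lambda(V).$$ A morphism between compact convex sets is a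 map that is the restriction of a linear map of the ambient spaces; a map $P^n\to W$ is multilinear if it is the restriction of a multilinear map of the ambient spaces. A convex body is a compact convex set with non-empty interior. A polytope is the convex hull of a finite set. A spectrahedron is a set $\{x: A+\sum_i x_iB_i\succeq 0\}$ with $A,B_i$ real symmetric matrices; an SDR set (projection of a spectrahedron) is a set $\{x:\exists y,\ A+\sum_i x_iB_i+\sum_j y_jC_j\succeq0\}$ with real symmetric $A,B_i,C_j$. **Theorem.** Let $V$ be a vector space of dimension $m$ and $P\subseteq V$ a compact convex set with $0\in P$. 1. $\mathbb S_\lambda$ is a functor from the category of compact convex sets containing the origin (in arbitrary finite-dimensional real vector spaces) to itself: $\mathbb S_\lambda(P)$ is a compact convex set containing $0$; if a morphism $f:P\to Q$ is the restriction of a linear map $L$, then $\mathbb S_\lambda(L)$ restricts to a morphism $\mathbb S_\lambda(f):\mathbb S_\lambda(P)\to\mathbb S_\lambda(Q)$ that does not depend on the choice of $L$, and identities and compositions are preserved. 2. Let $W$ be any compact convex set (in a finite-dimensional real vector space) and let $T:P^{n}\to W$ be any multilinear map satisfying the $\lambda$-exchange axioms. There is a unique morphism $t:\mathbb S_\lambda(P)\to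 W$ with $t\circ h_\lambda=T$. 3. If $P$ is a convex body, then $\mathbb S_\lambda(P)$ is a convex body in $\mathbb S_\lambda(V)$, and its dimension is the number of semistandard tableaux of shape $\lambda$ with entries in $\{1,\dots,m\}$. If $\lambda$ has more than one row, then $\mathbb S_\lambda(P)=-\mathbb S_\lambda(P)$. 4. If $E$ is the set of extreme points of $P$, then $\mathbb S_\lambda(P)=\operatorname{Conv}(h_\lambda(E^{n}))$. In particular, if $P$ is a polytope then so is $\mathbb S_\lambda(P)$. 5. Let $\nu$ be a finite Borel measure supported on $P$, i.e. $\nu(V\setminus P)=0$ and every neighbourhood of every point of $P$ has positive measure; if $P$ is a convex body, the restriction to $P$ of any Lebesgue (Haar) measure of $V$ is such a measure. For $k\ge 0$ let $Q_k$ be the set of linear functionals $\ell$ on $\mathbb S_\lambda(V)$ such that the symmetric bilinear form $$(a,b)\mapsto\int_{P^{n}}\big(1+\ell(h_\lambda(x))\big)\,a(x)\,b(x)\,d\nu^{n}(x)$$ on the polynomials of degree at most $k$ on $V^{n}$ is positive semidefinite, and let $Q_k^\circ=\{y\in\mathbb S_\lambda(V):\ell(y)\ge-1\text{ for all }\ell\in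 Q_k\}$. Then $Q_{k+1}\subseteq Q_k$, each $Q_k$ is a spectrahedron, each $Q_k^\circ$ is an SDR set, and $\mathbb S_\lambda(P)=\overline{\bigcup_k Q_k^\circ}$, i.e. $\nu$ determines an accurate approximation scheme for $\mathbb S_\lambda(P)$ by projections of spectrahedra. -/

import Mathlib

open MeasureTheory CategoryTheory Topology
open scoped TensorProduct

universe u v w

noncomputable section

namespace ConvexSchur

/-! ### Tableaux of vectors and the exchange axioms -/

/-- The boxes of the Young diagram `μ`; the box `(i, j)` lies in row `i` and column `j`. -/
abbrev Box (μ : YoungDiagram) : Type := {c : ℕ × ℕ // c ∈ μ.cells}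

/-- The box in row `i` of column `j`. -/
def colBox (μ : YoungDiagram) (j : ℕ) (i : Fin (μ.colLen j)) : Box μ :=
  ⟨((i : ℕ), j), (YoungDiagram.mem_cells _).2 (YoungDiagram.mem_iff_lt_colLen.2 i.2)⟩

instance orderEmbFintype (k l : ℕ) : Fintype (Fin k ↪o Fin l) :=
  Fintype.ofInjective (fun f => (f : Fin k → Fin l)) DFunLike.coe_injective

/-- The filling obtained from `v` by interchanging the entries in the boxes `f` of column `j₁`
with the entries in the boxes `g` of column `j₂`. A set of `k` boxes of a column is given by its
increasing enumeration, so the vertical order is kept. -/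
def exchange {μ : YoungDiagram} {X : Type*} {j₁ j₂ k : ℕ} (v : Box μ → X)
    (f : Fin k ↪o Fin (μ.colLen j₁)) (g : Fin k ↪o Fin (μ.colLen j₂)) : Box μ → X :=
  Function.extend (colBox μ j₁ ∘ f) (v ∘ colBox μ j₂ ∘ g)
    (Function.extend (colBox μ j₂ ∘ g) (v ∘ colBox μ j₁ ∘ f) v)

/-- The exchange axioms of shape `μ`: `T` vanishes on fillings with two equal entries in a column,
and, for two columns and a given set of boxes in the right one, `T v` is the sum of `T` over all
fillings obtained from `v` by exchanging these boxes with equally many boxes of the left one. -/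
structure ExchangeAxioms (μ : YoungDiagram) {X E : Type*} [AddCommGroup E]
    (T : (Box μ → X) → E) : Prop where
  alternating : ∀ (v : Box μ → X) (b b' : Box μ), b ≠ b' → b.1.2 = b'.1.2 → v b = v b' → T v = 0
  exchange : ∀ (j₁ j₂ : ℕ), j₁ < j₂ → ∀ (k : ℕ) (g : Fin k ↪o Fin (μ.colLen j₂)) (v : Box μ → X),
    T v = ∑ f : Fin k ↪o Fin (μ.colLen j₁), T (exchange v f g)

/-! ### The Schur functor on vector spaces -/

section Schur

variable (μ : YoungDiagram) (V : Type u) [AddCommGroup V] [Module ℝ V]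

/-- The relations imposed on the tensor power by the exchange axioms. -/
def schurRel : Submodule ℝ (⨂[ℝ] _ : Box μ, V) :=
  Submodule.span ℝ
    ({z | ∃ (v : Box μ → V) (b b' : Box μ), b ≠ b' ∧ b.1.2 = b'.1.2 ∧ v b = v b' ∧
        z = PiTensorProduct.tprod ℝ v} ∪
     {z | ∃ (j₁ j₂ : ℕ), j₁ < j₂ ∧ ∃ (k : ℕ) (g : Fin k ↪o Fin (μ.colLen j₂)) (v : Box μ → V),
        z = PiTensorProduct.tprod ℝ v -
          ∑ f : Fin k ↪o Fin (μ.colLen j₁), PiTensorProduct.tprod ℝ (exchange v f g)})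

/-- The Schur module `𝕊_μ(V)`. -/
abbrev SchurModule : Type u := (⨂[ℝ] _ : Box μ, V) ⧸ schurRel μ V

/-- The Euclidean topology of the Schur module. On a finite-dimensional real vector space the
module topology is the unique Hausdorff vector space topology. -/
instance schurTopology : TopologicalSpace (SchurModule μ V) :=
  moduleTopology ℝ (SchurModule μ V)

instance schurIsModuleTopology : IsModuleTopology ℝ (SchurModule μ V) := ⟨rfl⟩

/-- The universal multilinear map `h_μ`, sending a filling to the class of the tableau. -/
def schurH : MultilinearMap ℝ (fun _ : Box μ => V) (SchurModule μ V) :=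
  (schurRel μ V).mkQ.compMultilinearMap (PiTensorProduct.tprod ℝ)

variable {V}

variable {W : Type v} [AddCommGroup W] [Module ℝ W]

theorem comp_exchange {X Y : Type*} (φ : X → Y) {j₁ j₂ k : ℕ} (v : Box μ → X)
    (f : Fin k ↪o Fin (μ.colLen j₁)) (g : Fin k ↪o Fin (μ.colLen j₂)) :
    (fun c => φ (exchange v f g c)) = exchange (fun c => φ (v c)) f g := by
  funext c
  simp only [exchange, Function.extend_def, Function.comp_apply]
  split_ifs <;> rfl

theorem schurRel_le (L : V →ₗ[ℝ] W) :
    schurRel μ V ≤ (schurRel μ W).comap (PiTensorProduct.map fun _ : Box μ => L) := by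
  refine Submodule.span_le.2 ?_
  rintro z (⟨v, b, b', hb, hc, hv, rfl⟩ | ⟨j₁, j₂, hj, k, g, v, rfl⟩)
  · refine Submodule.subset_span (Or.inl ⟨fun c => L (v c), b, b', hb, hc, by simp [hv], ?_⟩)
    exact PiTensorProduct.map_tprod _ _
  · refine Submodule.subset_span (Or.inr ⟨j₁, j₂, hj, k, g, fun c => L (v c), ?_⟩)
    simp only [map_sub, map_sum, PiTensorProduct.map_tprod, comp_exchange]

/-- The linear map `𝕊_μ(L)`, sending the class of the tableau `v` to the class of `L ∘ v`. -/
def schurMap (L : V →ₗ[ℝ] W) : SchurModule μ V →ₗ[ℝ] SchurModule μ W :=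
  (schurRel μ V).mapQ (schurRel μ W) (PiTensorProduct.map fun _ : Box μ => L) (schurRel_le μ L)

/-- `𝕊_μ(P) = Conv (h_μ (P × ⋯ × P))`. -/
def schurSet (P : Set V) : Set (SchurModule μ V) :=
  convexHull ℝ (schurH μ V '' Set.univ.pi fun _ => P)

theorem schurH_mem {P : Set V} (p : Box μ → P) : schurH μ V (fun c => (p c : V)) ∈ schurSet μ P :=
  subset_convexHull ℝ _ ⟨_, fun c _ => (p c).2, rfl⟩

end Schur

/-! ### The category of compact convex sets containing the origin -/

/-- A map between subsets of vector spaces that is the restriction of a linear map. -/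
def IsLinearRestriction {V : Type v} {W : Type w} [AddCommGroup V] [Module ℝ V]
    [AddCommGroup W] [Module ℝ W] {P : Set V} {Q : Set W} (f : P → Q) : Prop :=
  ∃ L : V →ₗ[ℝ] W, ∀ x : P, (f x : W) = L x

/-- Compact convex sets containing the origin. -/
structure IsCompactConvexZero {V : Type v} [AddCommGroup V] [Module ℝ V] [TopologicalSpace V]
    (P : Set V) : Prop where
  isCompact : IsCompact P
  convex : Convex ℝ P
  zero_mem : (0 : V) ∈ P

/-- A convex body: a full-dimensional compact convex set. -/
structure IsConvexBody {V : Type v} [AddCommGroup V] [Module ℝ V] [TopologicalSpace V]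
    (P : Set V) : Prop where
  isCompact : IsCompact P
  convex : Convex ℝ P
  interior_nonempty : (interior P).Nonempty

/-- A polytope: the convex hull of a finite set. -/
def IsPolytope {V : Type v} [AddCommGroup V] [Module ℝ V] (P : Set V) : Prop :=
  ∃ s : Set V, s.Finite ∧ P = convexHull ℝ s

/-- A compact convex set containing the origin in a finite-dimensional real vector space (with
its Euclidean topology). -/
structure CompactConvex : Type (u + 1) where
  space : Type u
  [addCommGroup : AddCommGroup space]
  [module : Module ℝ space]
  [finite : FiniteDimensional ℝ space]
  [topology : TopologicalSpace space]
  [isModuleTopology : IsModuleTopology ℝ space]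
  carrier : Set space
  isCompactConvexZero : IsCompactConvexZero carrier

attribute [instance] CompactConvex.addCommGroup CompactConvex.module CompactConvex.finite
  CompactConvex.topology CompactConvex.isModuleTopology

namespace CompactConvex

/-- Morphisms are the restrictions of linear maps. -/
@[ext]
structure Hom (P Q : CompactConvex.{u}) : Type u where
  toFun : P.carrier → Q.carrier
  isLinearRestriction : IsLinearRestriction toFun

instance category : Category CompactConvex.{u} where
  Hom := Hom
  id P := ⟨id, LinearMap.id, fun _ => rfl⟩
  comp {P Q R} f g := ⟨g.toFun ∘ f.toFun, by
    obtain ⟨L, hL⟩ := f.isLinearRestriction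
    obtain ⟨M, hM⟩ := g.isLinearRestriction
    exact ⟨M ∘ₗ L, fun x => by simp [hL, hM]⟩⟩

/-- The morphism `f` is the restriction of the linear map `L`. -/
def IsRestrictionOf {P Q : CompactConvex.{u}} (f : P ⟶ Q) (L : P.space →ₗ[ℝ] Q.space) : Prop :=
  ∀ x : P.carrier, (Hom.toFun f x : Q.space) = L x

/-- The set `𝕊_μ(P)` as an object, once it is known to be compact, convex and to contain `0`. -/
def schurObj (μ : YoungDiagram) (P : CompactConvex.{u})
    (h : IsCompactConvexZero (schurSet μ P.carrier)) : CompactConvex.{u} where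
  space := SchurModule μ P.space
  carrier := schurSet μ P.carrier
  isCompactConvexZero := h

end CompactConvex

/-! ### Spectrahedra, their projections, and the approximation scheme -/

/-- A spectrahedron: the solution set of a linear matrix inequality `A + B x ⪰ 0`. -/
def IsSpectrahedron {E : Type v} [AddCommGroup E] [Module ℝ E] (S : Set E) : Prop :=
  ∃ (N : ℕ) (A : Matrix (Fin N) (Fin N) ℝ) (B : E →ₗ[ℝ] Matrix (Fin N) (Fin N) ℝ),
    A.IsSymm ∧ (∀ x, (B x).IsSymm) ∧ S = {x | (A + B x).PosSemidef}

/-- A projection of a spectrahedron (an SDR set). -/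
def IsSDR {E : Type v} [AddCommGroup E] [Module ℝ E] (S : Set E) : Prop :=
  ∃ (N d : ℕ) (A : Matrix (Fin N) (Fin N) ℝ) (B : E →ₗ[ℝ] Matrix (Fin N) (Fin N) ℝ)
    (C : (Fin d → ℝ) →ₗ[ℝ] Matrix (Fin N) (Fin N) ℝ),
    A.IsSymm ∧ (∀ x, (B x).IsSymm) ∧ (∀ y, (C y).IsSymm) ∧
      S = {x | ∃ y, (A + B x + C y).PosSemidef}

/-- The polar `{y | ∀ ℓ ∈ Q, ℓ y ≥ -1}` of a set of functionals. -/
def polar {E : Type v} [AddCommGroup E] [Module ℝ E] (Q : Set (Module.Dual ℝ E)) : Set E :=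
  {y | ∀ ℓ ∈ Q, -1 ≤ ℓ y}

/-- A finite measure supported on `P`: it lives on `P`, and every neighbourhood of every point of
`P` has positive measure. -/
structure IsSupportedOn {V : Type v} [TopologicalSpace V] [MeasurableSpace V] (ν : Measure V)
    (P : Set V) : Prop where
  finite : IsFiniteMeasure ν
  compl_eq_zero : ν Pᶜ = 0
  pos : ∀ x ∈ P, ∀ U ∈ 𝓝 x, 0 < ν U

section Scheme

variable (μ : YoungDiagram) {V : Type u} [AddCommGroup V] [Module ℝ V] [FiniteDimensional ℝ V]

/-- The value at `x` of a polynomial in the coordinates of the vectors in the boxes. -/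
def evalPoly (a : MvPolynomial (Box μ × Fin (Module.finrank ℝ V)) ℝ) (x : Box μ → V) : ℝ :=
  MvPolynomial.eval
    (fun t : Box μ × Fin (Module.finrank ℝ V) => (Module.finBasis ℝ V).repr (x t.1) t.2) a

variable [MeasurableSpace V]

/-- The symmetric bilinear form `∫ (1 + ℓ (h_μ x)) a(x) b(x)` over `P × ⋯ × P` with respect to the
product of copies of `ν`. -/
def momentForm (P : Set V) (ν : Measure V) (ℓ : Module.Dual ℝ (SchurModule μ V))
    (a b : MvPolynomial (Box μ × Fin (Module.finrank ℝ V)) ℝ) : ℝ :=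
  ∫ x in Set.univ.pi (fun _ : Box μ => P),
    (1 + ℓ (schurH μ V x)) * evalPoly μ a x * evalPoly μ b x ∂(Measure.pi fun _ : Box μ => ν)

/-- The set `Q_k` of functionals whose form is positive semidefinite on polynomials of degree at
most `k`. -/
def schemeQ (P : Set V) (ν : Measure V) (k : ℕ) : Set (Module.Dual ℝ (SchurModule μ V)) :=
  {ℓ | ∀ a : MvPolynomial (Box μ × Fin (Module.finrank ℝ V)) ℝ,
    a.totalDegree ≤ k → 0 ≤ momentForm μ P ν ℓ a a}

/-- The polars of the sets `Q_k` form an accurate approximation scheme for `𝕊_μ(P)` by projections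
of spectrahedra. -/
structure IsAccurateScheme (P : Set V) (ν : Measure V) : Prop where
  antitone : Antitone (schemeQ μ P ν)
  spectrahedron : ∀ k, IsSpectrahedron (schemeQ μ P ν k)
  sdr : ∀ k, IsSDR (polar (schemeQ μ P ν k))
  accurate : schurSet μ P = closure (⋃ k, polar (schemeQ μ P ν k))

end Scheme

end ConvexSchur

end

open ConvexSchur

/-! The convex statements come from two facts: a multilinear map is affine in each argument
separately, and a compact convex set in finite dimension is the intersection of the half-spaces
containing it. Changing one argument at a time shows that passing from a set to its convex hull does
not enlarge the hull of the multilinear image (`image_convexHull_multilinear`). With Minkowski's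
theorem this gives the description by extreme points. Compactness follows from Carathéodory's
theorem. A linear map is determined on `schurSet μ P` by its values on tableaux with entries in `P`,
which gives functoriality and uniqueness of linearizations. For existence, a multilinear map known
to satisfy the axioms only on `P` is composed with a projection onto the span of `P`.

The dimension is that of the whole Schur module, because `P` spans `V`. Semistandard tableaux span
it by straightening: column swaps and exchanges rewrite any other tableau through ones of larger
weight (`schurH_mem_span_semistandard`). They are independent because products of generic column
determinants satisfy the exchange axioms, by Sylvester's identity (`det_mul_alternating`), and the
diagonal monomials make the images of semistandard tableaux unitriangular (`coeff_tabDet`).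

For the scheme, an orthonormal family of polynomials turns the condition defining `Q_k` into `1 +
ℓ(H) ⪰ 0`. The polar of this spectrahedron is the linear image of the positive semidefinite matrices
of trace at most one, hence an SDR set. A functional lying in every `Q_k` makes `1 + ℓ ∘ h`
nonnegative on the product of copies of `P`: by Weierstrass approximation, squares of polynomials
detect negativity on the support of the measure. Separating hyperplanes then identify `schurSet μ P`
with the closure of the union of the polars. -/

namespace ConvexSchur

/-! ### Convexity in finite-dimensional spaces -/

section ModuleTopology

variable (E : Type*) [AddCommGroup E] [Module ℝ E] [FiniteDimensional ℝ E]
  [TopologicalSpace E] [IsModuleTopology ℝ E]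

/-- A finite-dimensional real space with the module topology is linearly homeomorphic to a
Euclidean space. -/
noncomputable def euclideanEquiv : E ≃L[ℝ] EuclideanSpace ℝ (Fin (Module.finrank ℝ E)) :=
  let e : E ≃ₗ[ℝ] EuclideanSpace ℝ (Fin (Module.finrank ℝ E)) :=
    LinearEquiv.ofFinrankEq _ _ (by simp)
  { e with
    continuous_toFun := IsModuleTopology.continuous_of_linearMap e.toLinearMap
    continuous_invFun := by
      have := IsModuleTopology.topologicalAddGroup ℝ E
      exact LinearMap.continuous_of_finiteDimensional e.symm.toLinearMap }

theorem t2Space_of_isModuleTopology : T2Space E :=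
  (euclideanEquiv E).toHomeomorph.symm.t2Space

theorem secondCountable_of_isModuleTopology : SecondCountableTopology E :=
  (euclideanEquiv E).toHomeomorph.secondCountableTopology

theorem locallyConvexSpace_of_isModuleTopology : LocallyConvexSpace ℝ E := by
  have := IsModuleTopology.topologicalAddGroup ℝ E
  have h := (euclideanEquiv E).toHomeomorph.isInducing.eq_induced
  convert LocallyConvexSpace.induced (𝕜 := ℝ) (euclideanEquiv E).toLinearEquiv.toLinearMap
  exact h

end ModuleTopology

/-- Expanding every argument in a basis writes `M` as a finite sum of products of coordinate
functionals times constant vectors. -/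
theorem continuous_multilinearMap {ι V E : Type*} [Finite ι] [AddCommGroup V] [Module ℝ V]
    [FiniteDimensional ℝ V] [TopologicalSpace V] [IsModuleTopology ℝ V]
    [AddCommGroup E] [Module ℝ E] [TopologicalSpace E] [IsModuleTopology ℝ E]
    (M : MultilinearMap ℝ (fun _ : ι => V) E) : Continuous M := by
  classical
  have := Fintype.ofFinite ι
  have := IsModuleTopology.toContinuousAdd ℝ E
  let b := Module.finBasis ℝ V
  have h : (M : (ι → V) → E) = fun v => ∑ r : ι → Fin (Module.finrank ℝ V),
      (∏ c, b.coord (r c) (v c)) • M fun c => b (r c) := by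
    funext v
    conv_lhs => rw [show v = fun c => ∑ i, b.coord i (v c) • b i from
      funext fun c => (b.sum_repr (v c)).symm]
    rw [M.map_sum]
    exact Finset.sum_congr rfl fun r _ => M.map_smul_univ _ _
  rw [h]
  refine continuous_finsetSum _ fun r _ => Continuous.smul ?_ continuous_const
  exact continuous_finsetProd _ fun c _ =>
    (IsModuleTopology.continuous_of_linearMap _).comp (continuous_apply c)

theorem sum_eq_sum_of_embedding {ι κ F : Type*} [Fintype ι] [Fintype κ] [AddCommMonoid F]
    (g : ι ↪ κ) {a : ι → F} {q : κ → F} (h₁ : ∀ i, q (g i) = a i)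
    (h₂ : ∀ i, i ∉ Set.range g → q i = 0) : ∑ i, q i = ∑ i, a i := by
  rw [← Finset.sum_congr rfl fun i _ => h₁ i]
  exact (Finset.sum_of_injOn g g.injective.injOn (by simp)
    (fun i _ hi => h₂ i (by simpa using hi)) fun _ _ => rfl).symm

/-- By Carathéodory, `finrank + 1` points suffice, so the hull is the continuous image of simplex ×
`s^d`. Shorter combinations are padded with weight zero at the point `s₀`. -/
theorem isCompact_convexHull_of_isCompact {E : Type*} [AddCommGroup E] [Module ℝ E]
    [FiniteDimensional ℝ E] [TopologicalSpace E] [ContinuousAdd E] [ContinuousSMul ℝ E]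
    {s : Set E} (hs : IsCompact s) : IsCompact (convexHull ℝ s) := by
  classical
  rcases s.eq_empty_or_nonempty with rfl | ⟨s₀, hs₀⟩
  · simp
  let d := Module.finrank ℝ E + 1
  let Φ : (Fin d → ℝ) × (Fin d → E) → E := fun p => ∑ i, p.1 i • p.2 i
  have hΦ : Continuous Φ := by fun_prop
  have himg : convexHull ℝ s = Φ '' (stdSimplex ℝ (Fin d) ×ˢ Set.univ.pi fun _ => s) := by
    apply Set.Subset.antisymm
    · intro x hx
      obtain ⟨ι, _, z, w, hz, hind, hw, hw1, hwx⟩ := eq_pos_convex_span_of_mem_convexHull hx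
      have hcard : Fintype.card ι ≤ Fintype.card (Fin d) := by
        rw [Fintype.card_fin]
        exact hind.card_le_finrank_succ.trans (Nat.succ_le_succ (Submodule.finrank_le _))
      obtain ⟨g⟩ := Function.Embedding.nonempty_of_card_le hcard
      have hwg : ∀ i, Function.extend g w (fun _ => 0) (g i) = w i := g.injective.extend_apply w _
      have hwn : ∀ i, i ∉ Set.range g → Function.extend g w (fun _ => 0) i = 0 :=
        fun i hi => Function.extend_apply' w _ i hi
      refine ⟨(Function.extend g w (fun _ => 0), Function.extend g z fun _ => s₀), ⟨⟨?_, ?_⟩, ?_⟩, ?_⟩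
      · intro i
        by_cases hi : i ∈ Set.range g
        · obtain ⟨i, rfl⟩ := hi
          simpa only [hwg] using (hw i).le
        · exact (hwn i hi).ge
      · rw [← hw1]
        exact sum_eq_sum_of_embedding g hwg hwn
      · intro i _
        by_cases hi : i ∈ Set.range g
        · obtain ⟨i, rfl⟩ := hi
          simpa only [g.injective.extend_apply] using hz ⟨i, rfl⟩
        · simpa only [Function.extend_apply' _ _ _ hi] using hs₀
      · rw [← hwx]
        refine sum_eq_sum_of_embedding g (fun i => ?_) fun i hi => ?_
        · simp only [g.injective.extend_apply]
        · simp only [hwn i hi, zero_smul]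
    · rintro _ ⟨⟨w, z⟩, ⟨hw, hz⟩, rfl⟩
      exact (convex_convexHull ℝ s).sum_mem (fun i _ => hw.1 i) hw.2
        fun i _ => subset_convexHull ℝ s (hz i trivial)
  rw [himg]
  exact ((isCompact_stdSimplex ℝ _).prod (isCompact_univ_pi fun _ => hs)).image hΦ

/-- Minkowski's theorem, in a normed space. -/
theorem subset_convexHull_extremePoints_of_normed (n : ℕ) : ∀ (E : Type u)
    [NormedAddCommGroup E] [NormedSpace ℝ E] [FiniteDimensional ℝ E],
    Module.finrank ℝ E = n → ∀ P : Set E, IsCompact P → Convex ℝ P →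
      P ⊆ convexHull ℝ (P.extremePoints ℝ) := by
  induction n using Nat.strong_induction_on with
  | _ n ih =>
  intro E _ _ _ hn P hP hPc x hx
  set C := convexHull ℝ (P.extremePoints ℝ) with hC
  -- Krein–Milman; the rest of the argument removes the closure.
  have hCP : closure C = P := closure_convexHull_extremePoints hP hPc
  by_contra hxC
  -- A nonzero functional is maximized over `P` at `x`. If `C` has interior, Hahn–Banach separates
  -- `x` from that interior; otherwise `P` lies in a proper affine subspace, on which some nonzero
  -- functional is constant.
  have key : ∃ f : E →L[ℝ] ℝ, f ≠ 0 ∧ ∀ y ∈ P, f y ≤ f x := by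
    by_cases hspan : affineSpan ℝ C = ⊤
    · have hint := ((convex_convexHull ℝ _).interior_nonempty_iff_affineSpan_eq_top (s := C)).2 hspan
      obtain ⟨f, hf⟩ := geometric_hahn_banach_open_point (convex_convexHull ℝ _).interior
        isOpen_interior (fun h => hxC (interior_subset h))
      refine ⟨f, ?_, fun y hy => ?_⟩
      · rintro rfl
        obtain ⟨c, hc⟩ := hint
        simpa using hf c hc
      · rw [← hCP, ← (convex_convexHull ℝ _).closure_interior_eq_closure_of_nonempty_interior hint]
          at hy
        exact closure_minimal (fun a ha => (hf a ha).le)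
          (isClosed_le f.continuous continuous_const) hy
    · have hPs : P ⊆ affineSpan ℝ C := by
        rw [← hCP]
        exact closure_minimal (subset_affineSpan ℝ C) (AffineSubspace.closed_of_finiteDimensional _)
      have hdir : (affineSpan ℝ C).direction < ⊤ := by
        refine lt_top_iff_ne_top.2 fun h => hspan ?_
        exact (AffineSubspace.direction_eq_top_iff_of_nonempty ⟨x, hPs hx⟩).1 h
      obtain ⟨f, hf, hker⟩ := Submodule.exists_le_ker_of_lt_top _ hdir
      refine ⟨LinearMap.toContinuousLinearMap f, by simpa using hf, fun y hy => ?_⟩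
      have := hker (AffineSubspace.vsub_mem_direction (hPs hy) (hPs hx))
      rw [LinearMap.mem_ker, vsub_eq_sub, map_sub, sub_eq_zero] at this
      exact this.le
  obtain ⟨f, hf, hfx⟩ := key
  let K := LinearMap.ker f.toLinearMap
  have hK : Module.finrank ℝ K < n := by
    rw [← hn]
    refine Submodule.finrank_lt fun h => hf ?_
    exact ContinuousLinearMap.coe_injective (LinearMap.ker_eq_top.1 h)
  -- The face of `P` through `x`, translated so that `x` becomes the origin of the smaller space
  -- `K`; the induction hypothesis applies there.
  let Q : Set K := {y | x + (y : E) ∈ P}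
  have hQ : IsCompact Q := by
    have hemb : IsClosedEmbedding fun y : K => x + (y : E) :=
      (Homeomorph.addLeft x).isClosedEmbedding.comp
        (Submodule.closed_of_finiteDimensional K).isClosedEmbedding_subtypeVal
    exact hemb.isCompact_preimage hP
  have hQc : Convex ℝ Q := by
    intro a ha b hb s t hs ht hst
    have := hPc ha hb hs ht hst
    change x + ((s • a + t • b : K) : E) ∈ P
    convert this using 1
    push_cast
    rw [smul_add, smul_add, add_add_add_comm, ← add_smul, hst, one_smul]
  have h0 := ih _ hK K rfl Q hQ hQc (show (0 : K) ∈ Q by simpa [Q] using hx)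
  let A : K →ᵃ[ℝ] E := (AffineMap.const ℝ K x) + K.subtype.toAffineMap
  have hA : ∀ y, A y = x + (y : E) := fun y => by simp [A]
  have hx' : x ∈ convexHull ℝ (A '' Q.extremePoints ℝ) := by
    rw [← AffineMap.image_convexHull]
    exact ⟨0, h0, by simp [hA]⟩
  refine hxC (convexHull_mono ?_ hx')
  rintro _ ⟨y, hy, rfl⟩
  rw [mem_extremePoints] at hy
  rw [mem_extremePoints, hA]
  refine ⟨hy.1, fun a ha b hb hab => ?_⟩
  -- Since `f` is maximal on the face and both weights are positive, the endpoints of a segment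
  -- through a point of the face lie on the face. Hence extreme points of the face are extreme in
  -- `P`.
  obtain ⟨s, t, hs, ht, hst, hab⟩ := hab
  have hval : s * f a + t * f b = f x := by
    have := congrArg f hab
    have hy0 : f (y : E) = 0 := y.2
    simpa [hy0] using this
  have hfa : f a = f x := by
    have := hfx a ha
    have := hfx b hb
    have : s * f x + t * f x = f x := by rw [← add_mul, hst, one_mul]
    nlinarith
  have hfb : f b = f x := by
    have := hfx a ha
    have := hfx b hb
    have : s * f x + t * f x = f x := by rw [← add_mul, hst, one_mul]
    nlinarith
  have hmem : ∀ c ∈ P, f c = f x → ∃ z ∈ Q, x + (z : E) = c := fun c hc hfc =>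
    ⟨⟨c - x, by change f (c - x) = 0; rw [map_sub, hfc, sub_self]⟩,
      show x + (c - x) ∈ P by simpa using hc, by simp⟩
  obtain ⟨a', ha', rfl⟩ := hmem a ha hfa
  obtain ⟨b', hb', rfl⟩ := hmem b hb hfb
  have : y ∈ openSegment ℝ a' b' := by
    refine ⟨s, t, hs, ht, hst, Subtype.ext ?_⟩
    rw [smul_add, smul_add, add_add_add_comm, ← add_smul, hst, one_smul] at hab
    simpa using hab
  obtain ⟨h1, h2⟩ := hy.2 a' ha' b' hb' this
  exact ⟨by rw [h1], by rw [h2]⟩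

/-- Minkowski's theorem: a compact convex set is the convex hull of its extreme points. -/
theorem convexHull_extremePoints_eq {V : Type*} [AddCommGroup V] [Module ℝ V]
    [FiniteDimensional ℝ V] [TopologicalSpace V] [IsModuleTopology ℝ V] {P : Set V}
    (hP : IsCompact P) (hPc : Convex ℝ P) : convexHull ℝ (P.extremePoints ℝ) = P := by
  refine Set.Subset.antisymm (convexHull_min extremePoints_subset hPc) ?_
  let e := euclideanEquiv V
  have h := subset_convexHull_extremePoints_of_normed _ _ rfl (e '' P)
    (hP.image e.continuous) (hPc.linear_image e.toLinearEquiv.toLinearMap)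
  rw [← image_extremePoints e P] at h
  have h2 := LinearMap.image_convexHull e.toLinearEquiv.toLinearMap (P.extremePoints ℝ)
  intro x hx
  have h3 := h ⟨x, hx, rfl⟩
  change e x ∈ convexHull ℝ (e.toLinearEquiv.toLinearMap '' P.extremePoints ℝ) at h3
  rw [← h2] at h3
  obtain ⟨y, hy, hxy⟩ := h3
  rwa [← e.injective hxy]

theorem vectorSpan_eq_span_of_zero_mem {V : Type*} [AddCommGroup V] [Module ℝ V] {s : Set V}
    (h0 : (0 : V) ∈ s) : vectorSpan ℝ s = Submodule.span ℝ s := by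
  rw [vectorSpan_eq_span_vsub_set_right ℝ h0]
  simp

/-- As `0 ∈ P`, the affine span of `P` is its linear span, and a convex set with full affine span
has interior. -/
theorem interior_nonempty_of_span_eq_top {V : Type*} [AddCommGroup V] [Module ℝ V]
    [FiniteDimensional ℝ V] [TopologicalSpace V] [IsModuleTopology ℝ V] {P : Set V}
    (hPc : Convex ℝ P) (h0 : (0 : V) ∈ P) (hspan : Submodule.span ℝ P = ⊤) :
    (interior P).Nonempty := by
  let e := euclideanEquiv V
  have hc : Convex ℝ (e '' P) := hPc.linear_image e.toLinearEquiv.toLinearMap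
  have h := hc.interior_nonempty_iff_affineSpan_eq_top.2 (by
    have hs : Submodule.span ℝ (e '' P) = ⊤ := by
      have := Submodule.map_span e.toLinearEquiv.toLinearMap P
      rw [hspan, Submodule.map_top, LinearEquiv.range] at this
      exact this.symm
    have h0' : (0 : EuclideanSpace ℝ (Fin (Module.finrank ℝ V))) ∈ e '' P := ⟨0, h0, map_zero e⟩
    rw [← AffineSubspace.direction_eq_top_iff_of_nonempty ⟨0, subset_affineSpan ℝ _ h0'⟩,
      direction_affineSpan, vectorSpan_eq_span_of_zero_mem h0', hs])
  have := e.toHomeomorph.image_interior P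
  change e '' _ = interior (e '' P) at this
  rw [← this] at h
  exact h.of_image

theorem span_eq_top_of_interior_nonempty {V : Type*} [AddCommGroup V] [Module ℝ V]
    [FiniteDimensional ℝ V] [TopologicalSpace V] [IsModuleTopology ℝ V] {P : Set V}
    (h : (interior P).Nonempty) : Submodule.span ℝ P = ⊤ := by
  have := IsModuleTopology.topologicalAddGroup ℝ V
  exact Submodule.eq_top_of_nonempty_interior' _ (h.mono (interior_mono Submodule.subset_span))

/-! ### Coordinatewise induction for multilinear maps -/

/-- Coordinates are moved from `A` to `B` one at a time. The hypothesis `step` is what linearity in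
a single argument provides when `B` is the convex hull or the span of `A`. -/
theorem pi_induction {ι X : Type*} [Finite ι] [DecidableEq ι] {A B : Set X} {p : (ι → X) → Prop}
    (base : ∀ v, (∀ c, v c ∈ A) → p v)
    (step : ∀ v c, (∀ x ∈ A, p (Function.update v c x)) → ∀ x ∈ B, p (Function.update v c x)) :
    ∀ v, (∀ c, v c ∈ B) → p v := by
  have := Fintype.ofFinite ι
  have key : ∀ (s : Finset ι) (v : ι → X), (∀ c ∈ s, v c ∈ B) → (∀ c ∉ s, v c ∈ A) → p v := by
    intro s
    induction s using Finset.induction_on with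
    | empty => exact fun v _ h => base v fun c => h c (Finset.notMem_empty c)
    | insert c s hc ih =>
      intro v h₁ h₂
      rw [← Function.update_eq_self c v]
      refine step v c (fun x hx => ih _ (fun d hd => ?_) fun d hd => ?_) _
        (h₁ c (Finset.mem_insert_self c s))
      · rw [Function.update_of_ne (ne_of_mem_of_not_mem hd hc)]
        exact h₁ d (Finset.mem_insert_of_mem hd)
      · by_cases hdc : d = c
        · subst hdc
          rwa [Function.update_self]
        · rw [Function.update_of_ne hdc]
          exact h₂ d (by simp [hdc, hd])
  exact fun v hv => key Finset.univ v (fun c _ => hv c) fun c hc => absurd (Finset.mem_univ c) hc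

section Multilinear

variable {ι V E : Type*} [Finite ι] [AddCommGroup V] [Module ℝ V] [AddCommGroup E] [Module ℝ E]
  (M : MultilinearMap ℝ (fun _ : ι => V) E)

theorem multilinear_mem_of_convexHull {A : Set V} {K : Set E} (hK : Convex ℝ K)
    (h : ∀ v : ι → V, (∀ c, v c ∈ A) → M v ∈ K) {v : ι → V} (hv : ∀ c, v c ∈ convexHull ℝ A) :
    M v ∈ K := by
  classical
  refine pi_induction (p := fun v => M v ∈ K) h (fun v c hA x hx => ?_) v hv
  exact convexHull_min (t := M.toLinearMap v c ⁻¹' K) hA (hK.linear_preimage _) hx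

theorem multilinear_mem_of_span {A : Set V} {K : Submodule ℝ E}
    (h : ∀ v : ι → V, (∀ c, v c ∈ A) → M v ∈ K) {v : ι → V} (hv : ∀ c, v c ∈ Submodule.span ℝ A) :
    M v ∈ K := by
  classical
  refine pi_induction (p := fun v => M v ∈ K) (B := Submodule.span ℝ A) h
    (fun v c hA x hx => ?_) v hv
  exact Submodule.span_le (p := K.comap (M.toLinearMap v c)).2 hA hx

theorem multilinear_eq_of_span {M' : MultilinearMap ℝ (fun _ : ι => V) E} {A : Set V}
    (h : ∀ v : ι → V, (∀ c, v c ∈ A) → M v = M' v) {v : ι → V}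
    (hv : ∀ c, v c ∈ Submodule.span ℝ A) : M v = M' v := by
  have := multilinear_mem_of_span (M - M') (K := ⊥) (A := A)
    (fun v hv => by simp [h v hv]) hv
  simpa [sub_eq_zero] using this

theorem image_convexHull_multilinear (A : Set V) :
    convexHull ℝ (M '' Set.univ.pi fun _ => convexHull ℝ A) =
      convexHull ℝ (M '' Set.univ.pi fun _ => A) := by
  refine Set.Subset.antisymm (convexHull_min ?_ (convex_convexHull ℝ _))
    (convexHull_mono (Set.image_mono (Set.pi_mono fun _ _ => subset_convexHull ℝ A)))
  rintro _ ⟨v, hv, rfl⟩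
  exact multilinear_mem_of_convexHull M (convex_convexHull ℝ _)
    (fun v hv => subset_convexHull ℝ _ (Set.mem_image_of_mem _ fun c _ => hv c)) fun c => hv c trivial

end Multilinear

/-- A multilinear map that vanishes when two given arguments are equal elements of a convex set
changes its sign when these arguments are interchanged. -/
theorem multilinear_swap {ι V E : Type*} [DecidableEq ι] [AddCommGroup V] [Module ℝ V]
    [AddCommGroup E] [Module ℝ E] (M : MultilinearMap ℝ (fun _ : ι => V) E) {A : Set V} (hA : Convex ℝ A) {b b' : ι} (hb : b ≠ b')
    (h : ∀ v : ι → V, (∀ c, v c ∈ A) → v b = v b' → M v = 0) {v : ι → V} (hv : ∀ c, v c ∈ A) :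
    M (v ∘ Equiv.swap b b') = -M v := by
  let B : V → V → E := fun x y => M (Function.update (Function.update v b x) b' y)
  have hB₁ : ∀ x x' y, B (x + x') y = B x y + B x' y := fun x x' y => by
    simp only [B, Function.update_comm hb, M.map_update_add]
  have hB₂ : ∀ x y y', B x (y + y') = B x y + B x y' := fun x y y' => by
    simp only [B, M.map_update_add]
  have hS₁ : ∀ (r : ℝ) x y, B (r • x) y = r • B x y := fun r x y => by
    simp only [B, Function.update_comm hb, M.map_update_smul]
  have hS₂ : ∀ (r : ℝ) x y, B x (r • y) = r • B x y := fun r x y => by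
    simp only [B, M.map_update_smul]
  have h0 : ∀ z ∈ A, B z z = 0 := fun z hz => by
    refine h _ (fun c => ?_) (by simp [Function.update_of_ne hb])
    by_cases hc : c = b'
    · subst hc
      simpa using hz
    by_cases hc' : c = b
    · subst hc'
      simpa [hc] using hz
    · simpa [hc, hc'] using hv c
  -- Polarization at the midpoint rather than at the sum `v b + v b'`, which may leave the convex
  -- set `A`.
  have hmid := h0 _ (hA (hv b) (hv b') (by norm_num : (0 : ℝ) ≤ 1 / 2)
    (by norm_num : (0 : ℝ) ≤ 1 / 2) (by norm_num))
  rw [hB₁, hB₂, hB₂, hS₁, hS₁, hS₁, hS₁, hS₂, hS₂, hS₂, hS₂, h0 _ (hv b), h0 _ (hv b'), smul_zero,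
    smul_zero, zero_add, add_zero, ← smul_add, ← smul_add, smul_eq_zero_iff_right (by norm_num),
    smul_eq_zero_iff_right (by norm_num)] at hmid
  have e₁ : v ∘ Equiv.swap b b' = Function.update (Function.update v b (v b')) b' (v b) := by
    funext c
    by_cases hc : c = b'
    · subst hc
      simp
    by_cases hc' : c = b
    · subst hc'
      simp [hc]
    · simp [hc, hc', Equiv.swap_apply_of_ne_of_ne]
  have e₂ : B (v b) (v b') = M v := by simp [B]
  rw [e₁, ← e₂]
  exact eq_neg_of_add_eq_zero_right hmid

/-! ### Exchanges as permutations of the boxes -/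

section Exchange

variable {μ : YoungDiagram} {X : Type*} {j₁ j₂ k : ℕ}

theorem colBox_injective (j : ℕ) : Function.Injective (colBox μ j) := by
  intro a b h
  exact Fin.ext (congrArg (fun c : Box μ => c.1.1) h)

@[simp]
theorem colBox_col (j : ℕ) (i : Fin (μ.colLen j)) : (colBox μ j i).1.2 = j := rfl

theorem exists_colBox_eq (b : Box μ) : ∃ i, colBox μ b.1.2 i = b :=
  ⟨⟨b.1.1, YoungDiagram.mem_iff_lt_colLen.1 ((YoungDiagram.mem_cells _).1 b.2)⟩, rfl⟩

theorem colBox_ne (h : j₁ ≠ j₂) (a : Fin (μ.colLen j₁)) (b : Fin (μ.colLen j₂)) :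
    colBox μ j₁ a ≠ colBox μ j₂ b :=
  fun he => h (congrArg (fun c : Box μ => c.1.2) he)

variable (v : Box μ → X) (f : Fin k ↪o Fin (μ.colLen j₁)) (g : Fin k ↪o Fin (μ.colLen j₂))

theorem colBox_comp_injective (j : ℕ) (f : Fin k ↪o Fin (μ.colLen j)) :
    Function.Injective (colBox μ j ∘ f) :=
  (colBox_injective j).comp f.injective

theorem exchange_left (i : Fin k) :
    exchange v f g (colBox μ j₁ (f i)) = v (colBox μ j₂ (g i)) :=
  (colBox_comp_injective j₁ f).extend_apply _ _ i

theorem exchange_right (h : j₁ ≠ j₂) (i : Fin k) :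
    exchange v f g (colBox μ j₂ (g i)) = v (colBox μ j₁ (f i)) := by
  rw [exchange, Function.extend_apply' _ _ _ fun ⟨a, ha⟩ => colBox_ne h _ _ ha]
  exact (colBox_comp_injective j₂ g).extend_apply _ _ i

theorem exchange_of_ne {c : Box μ} (h₁ : ∀ i, colBox μ j₁ (f i) ≠ c)
    (h₂ : ∀ i, colBox μ j₂ (g i) ≠ c) : exchange v f g c = v c := by
  rw [exchange, Function.extend_apply', Function.extend_apply']
  · exact fun ⟨a, ha⟩ => h₂ a ha
  · exact fun ⟨a, ha⟩ => h₁ a ha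

theorem exchange_eq_comp : exchange v f g = v ∘ exchange id f g :=
  (comp_exchange μ v id f g).symm

theorem exchange_involutive (h : j₁ ≠ j₂) :
    Function.Involutive (exchange (id : Box μ → Box μ) f g) := by
  intro c
  by_cases h₁ : ∃ i, colBox μ j₁ (f i) = c
  · obtain ⟨i, rfl⟩ := h₁
    rw [exchange_left, id, exchange_right _ _ _ h, id]
  by_cases h₂ : ∃ i, colBox μ j₂ (g i) = c
  · obtain ⟨i, rfl⟩ := h₂
    rw [exchange_right _ _ _ h, id, exchange_left, id]
  push Not at h₁ h₂
  rw [exchange_of_ne _ _ _ h₁ h₂, id, exchange_of_ne _ _ _ h₁ h₂, id]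

/-- The permutation of the boxes underlying an exchange. -/
noncomputable def exchangePerm (h : j₁ ≠ j₂) : Equiv.Perm (Box μ) := (exchange_involutive f g h).toPerm

theorem exchange_eq_comp_perm (h : j₁ ≠ j₂) : exchange v f g = v ∘ exchangePerm f g h :=
  exchange_eq_comp v f g

end Exchange

/-! ### The universal property -/

section Universal

variable (μ : YoungDiagram) {V : Type u} [AddCommGroup V] [Module ℝ V]
  {E : Type v} [AddCommGroup E] [Module ℝ E]

theorem schurH_exchangeAxioms : ExchangeAxioms μ (schurH μ V) where
  alternating v b b' hb hc hv := by
    refine (Submodule.Quotient.mk_eq_zero _).2 (Submodule.subset_span (Or.inl ?_))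
    exact ⟨v, b, b', hb, hc, hv, rfl⟩
  exchange j₁ j₂ hj k g v := by
    have h : PiTensorProduct.tprod ℝ v - ∑ f : Fin k ↪o Fin (μ.colLen j₁),
        PiTensorProduct.tprod ℝ (exchange v f g) ∈ schurRel μ V :=
      Submodule.subset_span (Or.inr ⟨j₁, j₂, hj, k, g, v, rfl⟩)
    have h' := (Submodule.Quotient.eq _).2 h
    exact h'.trans (map_sum (schurRel μ V).mkQ _ _)

theorem span_range_schurH : Submodule.span ℝ (Set.range (schurH μ V)) = ⊤ := by
  have h : Set.range (schurH μ V) =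
      (schurRel μ V).mkQ '' Set.range (PiTensorProduct.tprod ℝ (s := fun _ : Box μ => V)) := by
    rw [← Set.range_comp]
    rfl
  rw [h, Submodule.span_image, PiTensorProduct.span_tprod_eq_top, Submodule.map_top,
    Submodule.range_mkQ]

theorem schurRel_le_ker_lift {M : MultilinearMap ℝ (fun _ : Box μ => V) E}
    (hM : ExchangeAxioms μ M) : schurRel μ V ≤ LinearMap.ker (PiTensorProduct.lift M) := by
  refine Submodule.span_le.2 ?_
  rintro z (⟨v, b, b', hb, hc, hv, rfl⟩ | ⟨j₁, j₂, hj, k, g, v, rfl⟩)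
  · simpa using hM.alternating v b b' hb hc hv
  · simpa [sub_eq_zero] using hM.exchange j₁ j₂ hj k g v

/-- The linear map on the Schur module induced by a multilinear map satisfying the exchange
axioms. -/
noncomputable def schurLift (M : MultilinearMap ℝ (fun _ : Box μ => V) E) (hM : ExchangeAxioms μ M) :
    SchurModule μ V →ₗ[ℝ] E :=
  (schurRel μ V).liftQ (PiTensorProduct.lift M) (schurRel_le_ker_lift μ hM)

@[simp]
theorem schurLift_schurH (M : MultilinearMap ℝ (fun _ : Box μ => V) E) (hM : ExchangeAxioms μ M)
    (v : Box μ → V) : schurLift μ M hM (schurH μ V v) = M v :=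
  PiTensorProduct.lift.tprod v

@[simp]
theorem schurMap_schurH {W : Type v} [AddCommGroup W] [Module ℝ W] (L : V →ₗ[ℝ] W)
    (v : Box μ → V) : schurMap μ L (schurH μ V v) = schurH μ W fun c => L (v c) :=
  congrArg (schurRel μ W).mkQ (PiTensorProduct.map_tprod _ v)

theorem schurH_swap {b b' : Box μ} (hb : b ≠ b') (hc : b.1.2 = b'.1.2) (v : Box μ → V) :
    schurH μ V (v ∘ Equiv.swap b b') = -schurH μ V v := by
  exact multilinear_swap (schurH μ V) convex_univ hb
    (fun v _ hv => (schurH_exchangeAxioms μ).alternating v b b' hb hc hv) fun _ => trivial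

/-- Two linear maps that agree on the tableaux with entries in `P` agree on `𝕊_μ(P)`. -/
theorem eq_on_schurSet {P : Set V} {s t : SchurModule μ V →ₗ[ℝ] E}
    (h : ∀ v : Box μ → V, (∀ c, v c ∈ P) → s (schurH μ V v) = t (schurH μ V v))
    {x : SchurModule μ V} (hx : x ∈ schurSet μ P) : s x = t x := by
  refine convexHull_min (t := {x | s x = t x}) ?_ ?_ hx
  · rintro _ ⟨v, hv, rfl⟩
    exact h v fun c => hv c trivial
  · exact (LinearMap.eqLocus s t).convex

theorem schurSet_convexHull (A : Set V) :
    schurSet μ (convexHull ℝ A) = convexHull ℝ (schurH μ V '' Set.univ.pi fun _ => A) :=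
  image_convexHull_multilinear _ A

theorem isPolytope_schurSet {P : Set V} (hP : IsPolytope P) : IsPolytope (schurSet μ P) := by
  obtain ⟨s, hs, rfl⟩ := hP
  exact ⟨_, (Set.Finite.pi fun _ => hs).image _, schurSet_convexHull μ s⟩

theorem schurMap_mapsTo {W : Type v} [AddCommGroup W] [Module ℝ W] {L : V →ₗ[ℝ] W} {P : Set V}
    {Q : Set W} (h : ∀ x ∈ P, L x ∈ Q) {x : SchurModule μ V} (hx : x ∈ schurSet μ P) :
    schurMap μ L x ∈ schurSet μ Q := by
  refine convexHull_min (t := schurMap μ L ⁻¹' schurSet μ Q) ?_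
    ((convex_convexHull ℝ _).linear_preimage _) hx
  rintro _ ⟨v, hv, rfl⟩
  change schurMap μ L _ ∈ schurSet μ Q
  rw [schurMap_schurH]
  exact subset_convexHull ℝ _ ⟨_, fun c _ => h _ (hv c trivial), rfl⟩

/-- Interchanging the two top boxes of the first column negates the class of a tableau and keeps its
entries in `P`. -/
theorem neg_mem_schurSet (h : 1 < μ.colLen 0) {P : Set V} {x : SchurModule μ V}
    (hx : x ∈ schurSet μ P) : -x ∈ schurSet μ P := by
  refine convexHull_min (t := (-LinearMap.id : _ →ₗ[ℝ] SchurModule μ V) ⁻¹' schurSet μ P) ?_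
    ((convex_convexHull ℝ _).linear_preimage _) hx
  rintro _ ⟨v, hv, rfl⟩
  change -schurH μ V v ∈ schurSet μ P
  have hb : colBox μ 0 ⟨0, by lia⟩ ≠ colBox μ 0 ⟨1, h⟩ := fun he => by
    simpa using colBox_injective 0 he
  rw [← schurH_swap μ hb rfl v]
  exact subset_convexHull ℝ _ ⟨_, fun c _ => hv _ trivial, rfl⟩

/-- Multilinear maps on `P` that satisfy the exchange axioms linearize uniquely on `𝕊_μ(P)`. -/
theorem existsUnique_linearization {P : Set V} (hP : Convex ℝ P) {W : Set E} (hW : Convex ℝ W)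
    (T : (Box μ → P) → W)
    (hM : ∃ M : MultilinearMap ℝ (fun _ : Box μ => V) E, ∀ p, (T p : E) = M fun c => (p c : V))
    (hT : ExchangeAxioms μ (fun p => (T p : E))) :
    ∃! t : schurSet μ P → W, IsLinearRestriction t ∧
      ∀ p : Box μ → P, t ⟨schurH μ V (fun c => (p c : V)), schurH_mem μ p⟩ = T p := by
  obtain ⟨M, hM⟩ := hM
  -- `M` is only known to satisfy the axioms for entries in `P`. Precomposing with the projection
  -- `π` onto the span of `P` makes them hold on all of `V` without changing values on `P`.
  obtain ⟨π, hπ⟩ := (Submodule.span ℝ P).subtype.exists_leftInverse_of_injective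
    (Submodule.ker_subtype _)
  have hTM : ∀ v : Box μ → V, ∀ hv : ∀ c, v c ∈ P, (T fun c => ⟨v c, hv c⟩ : E) = M v :=
    fun v hv => hM _
  have hzero : ∀ b b' : Box μ, b ≠ b' → b.1.2 = b'.1.2 → ∀ v : Box μ → V, (∀ c, v c ∈ P) →
      v b = v b' → M v = 0 := fun b b' hb hc v hv he => by
    rw [← hTM v hv]
    exact hT.alternating _ b b' hb hc (Subtype.ext he)
  have hexch : ∀ (j₁ j₂ : ℕ), j₁ < j₂ → ∀ (k : ℕ) (g : Fin k ↪o Fin (μ.colLen j₂))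
      (v : Box μ → V), (∀ c, v c ∈ P) →
      M v = ∑ f : Fin k ↪o Fin (μ.colLen j₁), M (exchange v f g) := by
    intro j₁ j₂ hj k g v hv
    rw [← hTM v hv]
    refine (hT.exchange j₁ j₂ hj k g _).trans (Finset.sum_congr rfl fun f _ => ?_)
    rw [hM, comp_exchange μ (fun x : P => (x : V))]
  let M' := M.compLinearMap fun _ : Box μ => (Submodule.span ℝ P).subtype ∘ₗ π
  have hM' : ExchangeAxioms μ M' := by
    refine ⟨fun v b b' hb hc hv => ?_, fun j₁ j₂ hj k g v => ?_⟩
    -- Vanishing on equal entries is not an equality of multilinear maps, so it does not extend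
    -- directly from `P` to its span. The sign rule under a swap is one and does extend; on equal
    -- entries it gives `2 M = 0`.
    · have h := multilinear_eq_of_span (A := P) (M.domDomCongr (Equiv.swap b b')) (M' := -M)
        (fun v hv => multilinear_swap M hP hb (hzero b b' hb hc) hv)
        (v := fun c => (π (v c) : V)) fun c => (π (v c)).2
      have h₂ : (fun c => ((π (v (Equiv.swap b b' c)) : Submodule.span ℝ P) : V)) =
          fun c => (π (v c) : V) := by
        funext c
        by_cases h₁ : c = b
        · rw [h₁, Equiv.swap_apply_left, hv]
        by_cases h₂ : c = b'
        · rw [h₂, Equiv.swap_apply_right, hv]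
        · rw [Equiv.swap_apply_of_ne_of_ne h₁ h₂]
      change M (fun c => ((π (v (Equiv.swap b b' c)) : Submodule.span ℝ P) : V)) =
        -M fun c => (π (v c) : V) at h
      rw [h₂] at h
      refine (smul_eq_zero_iff_right (two_ne_zero (α := ℝ))).1 ?_
      rw [two_smul]
      exact add_eq_zero_iff_eq_neg.2 h
    -- Each exchange is a fixed permutation of the boxes, so both sides are multilinear and their
    -- agreement on `P` extends to the span.
    · have h := multilinear_eq_of_span (A := P) M
        (M' := ∑ f : Fin k ↪o Fin (μ.colLen j₁), M.domDomCongr (exchangePerm f g hj.ne))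
        (fun v hv => by
          rw [hexch j₁ j₂ hj k g v hv, sum_apply]
          exact Finset.sum_congr rfl fun f _ => by
            rw [exchange_eq_comp_perm v f g hj.ne]; rfl)
        (v := fun c => (π (v c) : V)) fun c => (π (v c)).2
      refine h.trans ?_
      rw [sum_apply]
      exact Finset.sum_congr rfl fun f _ => by
        rw [exchange_eq_comp_perm v f g hj.ne]; rfl
  have hlift : ∀ v : Box μ → V, (∀ c, v c ∈ P) → schurLift μ M' hM' (schurH μ V v) = M v := by
    intro v hv
    rw [schurLift_schurH]
    refine congrArg M (funext fun c => ?_)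
    exact congrArg Subtype.val
      (LinearMap.congr_fun hπ ⟨v c, Submodule.subset_span (hv c)⟩)
  have hmaps : ∀ x ∈ schurSet μ P, schurLift μ M' hM' x ∈ W := by
    refine fun x hx => convexHull_min (t := schurLift μ M' hM' ⁻¹' W) ?_ (hW.linear_preimage _) hx
    rintro _ ⟨v, hv, rfl⟩
    have hv' : ∀ c, v c ∈ P := fun c => hv c trivial
    change schurLift μ M' hM' (schurH μ V v) ∈ W
    rw [hlift v hv', ← hTM v hv']
    exact (T _).2
  refine ⟨fun x => ⟨_, hmaps x x.2⟩, ⟨⟨_, fun _ => rfl⟩, fun p => Subtype.ext ?_⟩, ?_⟩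
  · exact (hlift _ fun c => (p c).2).trans (hM p).symm
  · rintro t ⟨⟨L, hL⟩, ht⟩
    refine funext fun x => Subtype.ext ?_
    rw [hL]
    refine eq_on_schurSet μ (fun v hv => ?_) x.2
    rw [hlift v hv, ← hTM v hv, ← ht, hL]

variable [FiniteDimensional ℝ V] [TopologicalSpace V] [IsModuleTopology ℝ V]

theorem isCompactConvexZero_schurSet (hμ : 0 < μ.card) {P : Set V} (hP : IsCompactConvexZero P) :
    IsCompactConvexZero (schurSet μ P) where
  isCompact := by
    have := IsModuleTopology.toContinuousAdd ℝ (SchurModule μ V)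
    exact isCompact_convexHull_of_isCompact
      ((isCompact_univ_pi fun _ => hP.isCompact).image (continuous_multilinearMap _))
  convex := convex_convexHull ℝ _
  zero_mem := by
    -- A box must exist for the zero filling to be sent to zero.
    obtain ⟨c, hc⟩ := Finset.card_pos.1 hμ
    refine subset_convexHull ℝ _ ⟨0, fun _ _ => hP.zero_mem, ?_⟩
    exact (schurH μ V).map_coord_zero (i := ⟨c, hc⟩) rfl

end Universal

/-! ### The Schur functor on compact convex sets -/

namespace CompactConvex

variable (μ : YoungDiagram) (hμ : 0 < μ.card)

/-- Makes the arbitrary choice of a linear extension in `schurFunctor` harmless. -/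
theorem schurMap_eq_of_isRestrictionOf {P Q : CompactConvex.{u}} {f : P ⟶ Q}
    {L L' : P.space →ₗ[ℝ] Q.space} (hL : IsRestrictionOf f L) (hL' : IsRestrictionOf f L')
    {x : SchurModule μ P.space} (hx : x ∈ schurSet μ P.carrier) :
    schurMap μ L x = schurMap μ L' x := by
  refine eq_on_schurSet μ (fun v hv => ?_) hx
  rw [schurMap_schurH, schurMap_schurH]
  congr 1
  funext c
  rw [← hL ⟨v c, hv c⟩, ← hL' ⟨v c, hv c⟩]

/-- The Schur functor on the category of compact convex sets containing the origin. -/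
noncomputable def schurFunctor : CompactConvex.{u} ⥤ CompactConvex.{u} where
  obj P := P.schurObj μ (isCompactConvexZero_schurSet μ hμ P.isCompactConvexZero)
  map {P Q} f := ⟨fun x => ⟨schurMap μ f.isLinearRestriction.choose x.1,
    schurMap_mapsTo μ (fun y hy => f.isLinearRestriction.choose_spec ⟨y, hy⟩ ▸
      (f.toFun ⟨y, hy⟩).2) x.2⟩, _, fun _ => rfl⟩
  map_id P := by
    refine Hom.ext (funext fun x => Subtype.ext ?_)
    refine (schurMap_eq_of_isRestrictionOf μ (f := 𝟙 P) (L' := LinearMap.id)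
      (Hom.isLinearRestriction (𝟙 P)).choose_spec (fun _ => rfl) x.2).trans ?_
    refine eq_on_schurSet (t := LinearMap.id) μ (fun v _ => ?_) x.2
    rw [schurMap_schurH]
    rfl
  map_comp {P Q R} f g := by
    refine Hom.ext (funext fun x => Subtype.ext ?_)
    have hf := (Hom.isLinearRestriction f).choose_spec
    have hg := (Hom.isLinearRestriction g).choose_spec
    refine (schurMap_eq_of_isRestrictionOf μ (f := f ≫ g)
      (L' := (Hom.isLinearRestriction g).choose ∘ₗ (Hom.isLinearRestriction f).choose)
      (Hom.isLinearRestriction (f ≫ g)).choose_spec (fun y => ?_) x.2).trans ?_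
    · rw [LinearMap.comp_apply, ← hf, ← hg]
      rfl
    · refine eq_on_schurSet (t := schurMap μ (Hom.isLinearRestriction g).choose ∘ₗ
        schurMap μ (Hom.isLinearRestriction f).choose) μ (fun v _ => ?_) x.2
      simp

theorem schurFunctor_isRestrictionOf {P Q : CompactConvex.{u}} (f : P ⟶ Q)
    (L : P.space →ₗ[ℝ] Q.space) (hL : IsRestrictionOf f L) :
    IsRestrictionOf (P := P.schurObj μ _) (Q := Q.schurObj μ _) ((schurFunctor μ hμ).map f)
      (schurMap μ L) :=
  fun x => schurMap_eq_of_isRestrictionOf μ (Hom.isLinearRestriction f).choose_spec hL x.2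

end CompactConvex

/-! ### Straightening: semistandard tableaux span the Schur module -/

section Straightening

variable {μ : YoungDiagram} {m : ℕ}

/-- A filling with entries in `Fin m` is semistandard if its rows increase weakly and its columns
increase strictly. -/
structure IsSemistandard (T : Box μ → Fin m) : Prop where
  row : ∀ c c' : Box μ, c.1.1 = c'.1.1 → c.1.2 < c'.1.2 → T c ≤ T c'
  col : ∀ c c' : Box μ, c.1.2 = c'.1.2 → c.1.1 < c'.1.1 → T c < T c'

/-- A statistic that grows when large entries move to columns further right. -/
def colWeight (T : Box μ → Fin m) : ℤ := ∑ c, (c.1.2 : ℤ) * 2 ^ (T c : ℕ)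

/-- A statistic that grows when large entries move further down. -/
def rowWeight (T : Box μ → Fin m) : ℤ := ∑ c, (c.1.1 : ℤ) * (T c : ℕ)

/-- Reindexing by the involution moves it from the entries to the box weights, so only boxes whose
weight changes contribute. -/
theorem sum_mul_comp_perm_sub (α : Box μ → ℤ) (β : Box μ → ℤ) (σ : Equiv.Perm (Box μ))
    (hσ : ∀ c, σ (σ c) = c) :
    ∑ c, α c * β (σ c) - ∑ c, α c * β c = ∑ c, (α (σ c) - α c) * β c := by
  rw [← Equiv.sum_comp σ fun c => α c * β (σ c), ← Finset.sum_sub_distrib]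
  simp only [hσ, sub_mul]

/-- The gain is the product of the row difference and the entry difference, both positive. -/
theorem rowWeight_swap {T : Box μ → Fin m} {b b' : Box μ} (hb : b.1.1 < b'.1.1) (hT : T b' < T b) :
    rowWeight T < rowWeight (T ∘ Equiv.swap b b') := by
  have hne : b ≠ b' := fun h => by simp [h] at hb
  rw [← sub_pos]
  refine lt_of_lt_of_eq ?_ (sum_mul_comp_perm_sub (fun c => (c.1.1 : ℤ)) (fun c => ((T c : ℕ) : ℤ))
    (Equiv.swap b b') (Equiv.swap_apply_self b b')).symm
  rw [Fintype.sum_eq_add b b' hne fun c hc => by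
    rw [Equiv.swap_apply_of_ne_of_ne hc.1 hc.2, sub_self, zero_mul]]
  rw [Equiv.swap_apply_left, Equiv.swap_apply_right]
  have h₁ : (0 : ℤ) < (b'.1.1 : ℤ) - b.1.1 := by lia
  have h₂ : (0 : ℤ) < ((T b : ℕ) : ℤ) - (T b' : ℕ) := by
    have := Fin.lt_def.1 hT
    lia
  have := mul_pos h₁ h₂
  linarith

theorem colWeight_swap (T : Box μ → Fin m) {b b' : Box μ} (hb : b.1.2 = b'.1.2) :
    colWeight (T ∘ Equiv.swap b b') = colWeight T := by
  rw [← sub_eq_zero]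
  refine (sum_mul_comp_perm_sub (fun c => (c.1.2 : ℤ)) (fun c => 2 ^ (T c : ℕ))
    (Equiv.swap b b') (Equiv.swap_apply_self b b')).trans (Finset.sum_eq_zero fun c _ => ?_)
  by_cases h₁ : c = b
  · rw [h₁, Equiv.swap_apply_left, hb, sub_self, zero_mul]
  by_cases h₂ : c = b'
  · rw [h₂, Equiv.swap_apply_right, hb, sub_self, zero_mul]
  · rw [Equiv.swap_apply_of_ne_of_ne h₁ h₂, sub_self, zero_mul]

theorem colWeight_exchange_sub (T : Box μ → Fin m) {j₁ j₂ k : ℕ} (hj : j₁ ≠ j₂)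
    (f : Fin k ↪o Fin (μ.colLen j₁)) (g : Fin k ↪o Fin (μ.colLen j₂)) :
    colWeight (exchange T f g) - colWeight T = ((j₂ : ℤ) - j₁) *
      (∑ i, 2 ^ (T (colBox μ j₁ (f i)) : ℕ) - ∑ i, 2 ^ (T (colBox μ j₂ (g i)) : ℕ)) := by
  let s : Fin k ⊕ Fin k ↪ Box μ :=
    ⟨Sum.elim (fun i => colBox μ j₁ (f i)) fun i => colBox μ j₂ (g i),
      (colBox_comp_injective j₁ f).sumElim (colBox_comp_injective j₂ g)
        fun a b => colBox_ne hj _ _⟩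
  rw [exchange_eq_comp_perm T f g hj]
  refine (sum_mul_comp_perm_sub (fun c => (c.1.2 : ℤ)) (fun c => 2 ^ (T c : ℕ))
    (exchangePerm f g hj) (exchange_involutive f g hj)).trans ?_
  rw [sum_eq_sum_of_embedding s (fun _ => rfl) fun c hc => ?_, Fintype.sum_sum_type]
  · have h₁ : ∀ i, exchangePerm f g hj (colBox μ j₁ (f i)) = colBox μ j₂ (g i) :=
      exchange_left id f g
    have h₂ : ∀ i, exchangePerm f g hj (colBox μ j₂ (g i)) = colBox μ j₁ (f i) :=
      exchange_right id f g hj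
    simp only [s, Function.Embedding.coeFn_mk, Sum.elim_inl, Sum.elim_inr, h₁, h₂, colBox_col,
      ← Finset.mul_sum]
    ring
  · have h : exchangePerm f g hj c = c :=
      exchange_of_ne id f g (fun i hi => hc ⟨Sum.inl i, hi⟩) fun i hi => hc ⟨Sum.inr i, hi⟩
    rw [h, sub_self, zero_mul]

theorem le_orderEmb {k l : ℕ} (f : Fin k ↪o Fin l) (i : Fin k) : (i : ℕ) ≤ f i := by
  obtain ⟨n, hn⟩ := i
  induction n with
  | zero => exact Nat.zero_le _
  | succ n ih =>
    have h : f ⟨n, by lia⟩ < f ⟨n + 1, hn⟩ := f.strictMono (Fin.lt_def.2 (Nat.lt_succ_self n))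
    exact (ih _).trans_lt (Fin.lt_def.1 h)

/-- The exchanged boxes of the right column are `c'` and those above it. Their entries are distinct
and at most `T c'`, so their powers of two sum to less than `2 ^ (T c' + 1)`. Any equally large set
of boxes in the left column reaches at least down to the row of `c`, so it has an entry `≥ T c > T
c'`, and that single power already dominates. -/
theorem colWeight_exchange_lt {T : Box μ → Fin m}
    (hcol : ∀ c c' : Box μ, c.1.2 = c'.1.2 → c.1.1 < c'.1.1 → T c < T c') {c c' : Box μ}
    (hrow : c.1.1 = c'.1.1) (hlt : c.1.2 < c'.1.2) (hT : T c' < T c)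
    (hk : c'.1.1 + 1 ≤ μ.colLen c'.1.2) (f : Fin (c'.1.1 + 1) ↪o Fin (μ.colLen c.1.2)) :
    colWeight T < colWeight (exchange T f (Fin.castLEOrderEmb hk)) := by
  rw [← sub_pos, colWeight_exchange_sub T hlt.ne]
  refine mul_pos (by lia) (sub_pos.2 ?_)
  set g : Fin (c'.1.1 + 1) ↪o Fin (μ.colLen c'.1.2) := Fin.castLEOrderEmb hk
  have hmono : ∀ {j : ℕ} {a b : Fin (μ.colLen j)}, a < b → T (colBox μ j a) < T (colBox μ j b) :=
    fun {j a b} h => hcol _ _ rfl (Fin.lt_def.1 h)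
  have hmono' : ∀ {j : ℕ} {a b : Fin (μ.colLen j)}, a ≤ b → T (colBox μ j a) ≤ T (colBox μ j b) :=
    fun {j a b} h => h.eq_or_lt.elim (fun h => h ▸ le_rfl) fun h => (hmono h).le
  have hlast : colBox μ c'.1.2 (g (Fin.last _)) = c' := rfl
  have h₁ : ∑ i, 2 ^ (T (colBox μ c'.1.2 (g i)) : ℕ) < 2 ^ ((T c' : ℕ) + 1) := by
    have hinj : Function.Injective fun i => (T (colBox μ c'.1.2 (g i)) : ℕ) :=
      StrictMono.injective fun a b hab => Fin.lt_def.1 (hmono (g.strictMono hab))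
    have := Nat.geomSum_lt (m := 2) (n := (T c' : ℕ) + 1) le_rfl
      (s := Finset.univ.map ⟨_, hinj⟩) (by
        intro x hx
        obtain ⟨i, -, rfl⟩ := Finset.mem_map.1 hx
        have := hmono' (g.monotone (Fin.le_last i))
        rw [hlast] at this
        exact Nat.lt_succ_of_le (Fin.le_def.1 this))
    rwa [Finset.sum_map] at this
  have h₂ : (T c : ℕ) ≤ T (colBox μ c.1.2 (f (Fin.last _))) := by
    obtain ⟨i, hi⟩ := exists_colBox_eq c
    have hic : (i : ℕ) = c'.1.1 := (congrArg (fun c : Box μ => c.1.1) hi).trans hrow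
    have hle : i ≤ f (Fin.last _) := Fin.le_def.2 (hic.trans_le (le_orderEmb f (Fin.last _)))
    have := Fin.le_def.1 (hmono' hle)
    rwa [hi] at this
  have h₃ : 2 ^ (T (colBox μ c.1.2 (f (Fin.last _))) : ℕ) ≤
      ∑ i, 2 ^ (T (colBox μ c.1.2 (f i)) : ℕ) :=
    Finset.single_le_sum (f := fun i => 2 ^ (T (colBox μ c.1.2 (f i)) : ℕ))
      (fun _ _ => Nat.zero_le _) (Finset.mem_univ _)
  have h₄ : 2 ^ ((T c' : ℕ) + 1) ≤ 2 ^ (T (colBox μ c.1.2 (f (Fin.last _))) : ℕ) :=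
    Nat.pow_le_pow_right two_pos ((Nat.succ_le_of_lt (Fin.lt_def.1 hT)).trans h₂)
  exact_mod_cast h₁.trans_le (h₄.trans h₃)

variable {V : Type u} [AddCommGroup V] [Module ℝ V]

/-- Straightening by induction on the lexicographic pair of weights. Sorting a column inversion
fixes `colWeight` and raises `rowWeight`; once columns are strict, a row violation is removed by an
exchange all of whose terms have larger `colWeight`. -/
theorem schurH_mem_span_semistandard (b : Fin m → V) (T : Box μ → Fin m) :
    schurH μ V (b ∘ T) ∈ Submodule.span ℝ
      ((fun T : Box μ → Fin m => schurH μ V (b ∘ T)) '' {T | IsSemistandard T}) := by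
  set S := Submodule.span ℝ
      ((fun T : Box μ → Fin m => schurH μ V (b ∘ T)) '' {T | IsSemistandard T})
  let wt : (Box μ → Fin m) → ℤ ×ₗ ℤ := fun T => toLex (colWeight T, rowWeight T)
  -- The relation runs from larger to smaller weight and is well-founded because there are finitely
  -- many fillings.
  have wf : WellFounded fun T T' => wt T' < wt T := by
    have : IsTrans (Box μ → Fin m) fun T T' => wt T' < wt T := ⟨fun a b c h₁ h₂ => h₂.trans h₁⟩
    have : Std.Irrefl fun T T' : Box μ → Fin m => wt T' < wt T := ⟨fun a => lt_irrefl _⟩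
    exact Finite.wellFounded_of_trans_of_irrefl _
  induction T using wf.induction with
  | _ T ih =>
  by_cases hcol : ∀ c c' : Box μ, c.1.2 = c'.1.2 → c.1.1 < c'.1.1 → T c < T c'
  · by_cases hrow : ∀ c c' : Box μ, c.1.1 = c'.1.1 → c.1.2 < c'.1.2 → T c ≤ T c'
    · exact Submodule.subset_span ⟨T, ⟨hrow, hcol⟩, rfl⟩
    · push Not at hrow
      obtain ⟨c, c', h₁, h₂, h₃⟩ := hrow
      have hk : c'.1.1 + 1 ≤ μ.colLen c'.1.2 :=
        YoungDiagram.mem_iff_lt_colLen.1 ((YoungDiagram.mem_cells _).1 c'.2)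
      rw [(schurH_exchangeAxioms μ).exchange _ _ h₂ _ (Fin.castLEOrderEmb hk)]
      refine Submodule.sum_mem _ fun f _ => ?_
      have h := ih _ (Prod.Lex.left _ _ (colWeight_exchange_lt hcol h₁ h₂ h₃ hk f))
      rwa [show b ∘ exchange T f (Fin.castLEOrderEmb hk) = _ from comp_exchange μ b T f _] at h
  · push Not at hcol
    obtain ⟨c, c', h₁, h₂, h₃⟩ := hcol
    have hne : c ≠ c' := fun h => by simp [h] at h₂
    rcases h₃.eq_or_lt with h₃ | h₃
    · rw [(schurH_exchangeAxioms μ).alternating _ c c' hne h₁ (congrArg b h₃.symm)]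
      exact Submodule.zero_mem _
    · have h := ih (T ∘ Equiv.swap c c')
        (Prod.Lex.toLex_lt_toLex.2 (Or.inr ⟨(colWeight_swap T h₁).symm, rowWeight_swap h₂ h₃⟩))
      rw [← Function.comp_assoc, schurH_swap μ hne h₁] at h
      simpa using h

theorem span_semistandard_eq_top (b : Module.Basis (Fin m) ℝ V) : Submodule.span ℝ
    ((fun T : Box μ → Fin m => schurH μ V (b ∘ T)) '' {T | IsSemistandard T}) = ⊤ := by
  rw [eq_top_iff, ← span_range_schurH μ, Submodule.span_le]
  rintro _ ⟨v, rfl⟩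
  refine multilinear_mem_of_span _ (A := Set.range b) (fun v hv => ?_) fun c => by
    rw [b.span_eq]; trivial
  choose T hT using hv
  have : v = b ∘ T := funext fun c => (hT c).symm
  rw [this]
  exact schurH_mem_span_semistandard _ T

end Straightening

/-! ### The exchange identity for determinants -/

section Sylvester

theorem extend_update {ι κ M : Type*} [DecidableEq ι] [DecidableEq κ] (f : κ ↪ ι) (w : κ → M)
    (v : ι → M) (i : κ) (x : M) :
    Function.extend f (Function.update w i x) v =
      Function.update (Function.extend f w v) (f i) x := by
  funext a
  by_cases ha : ∃ k, f k = a
  · obtain ⟨k, rfl⟩ := ha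
    rw [f.injective.extend_apply]
    by_cases hk : k = i
    · subst hk
      simp
    · rw [Function.update_of_ne hk, Function.update_of_ne (f.injective.ne hk),
        f.injective.extend_apply]
  · rw [Function.extend_apply' _ _ _ ha, Function.update_of_ne (fun h => ha ⟨i, h.symm⟩),
      Function.extend_apply' _ _ _ ha]

/-- The alternating map obtained by fixing the arguments outside the range of an embedding. -/
noncomputable def alternatingExtend {ι κ M N : Type*} [AddCommGroup M] [Module ℝ M]
    [AddCommGroup N] [Module ℝ N] (D : M [⋀^ι]→ₗ[ℝ] N) (f : κ ↪ ι) (v : ι → M) :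
    M [⋀^κ]→ₗ[ℝ] N where
  toFun w := D (Function.extend f w v)
  map_update_add' w i x y := by
    classical
    simp only [extend_update, D.map_update_add]
  map_update_smul' w i r x := by
    classical
    simp only [extend_update, D.map_update_smul]
  map_eq_zero_of_eq' w i j h hij := by
    refine D.map_eq_zero_of_eq (i := f i) (j := f j) _ ?_ (f.injective.ne hij)
    rw [f.injective.extend_apply, f.injective.extend_apply, h]

variable {p k : ℕ}

theorem exists_notMem_range_of_ne {f g : Fin k ↪o Fin p} (h : f ≠ g) :
    ∃ i, f i ∉ Set.range g := by
  by_contra! hfg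
  refine h (OrderEmbedding.range_inj.1 ?_)
  refine Set.eq_of_subset_of_ncard_le (Set.range_subset_iff.2 hfg) ?_
  rw [← Set.image_univ, ← Set.image_univ, Set.ncard_image_of_injective _ f.injective,
    Set.ncard_image_of_injective _ g.injective]

/-- Both sides are alternating in `w`, so it suffices to compare them on increasing subfamilies `b ∘
f₀` of the basis. There the term of `f ≠ f₀` has a repeated row, and the term of `f₀` is the left
side. -/
theorem det_mul_alternating_of_basis (F : (Fin p → ℝ) [⋀^Fin k]→ₗ[ℝ] ℝ)
    (b : Module.Basis (Fin p) ℝ (Fin p → ℝ)) (w : Fin k → Fin p → ℝ) :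
    Matrix.detRowAlternating (⇑b) * F w = ∑ f : Fin k ↪o Fin p,
      Matrix.detRowAlternating (Function.extend f w b) * F (b ∘ f) := by
  let D : (Fin p → ℝ) [⋀^Fin p]→ₗ[ℝ] ℝ := Matrix.detRowAlternating
  let A : (Fin p → ℝ) [⋀^Fin k]→ₗ[ℝ] ℝ := D b • F
  let B : (Fin p → ℝ) [⋀^Fin k]→ₗ[ℝ] ℝ :=
    ∑ f : Fin k ↪o Fin p, F (b ∘ f) • alternatingExtend D f.toEmbedding b
  have hB : ∀ w, B w = ∑ f : Fin k ↪o Fin p, D (Function.extend f w b) * F (b ∘ f) := by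
    intro w
    rw [show (B : (Fin k → Fin p → ℝ) → ℝ) w = ∑ f : Fin k ↪o Fin p,
      (F (b ∘ f) • alternatingExtend D f.toEmbedding b) w from
        map_sum (⟨⟨fun G : (Fin p → ℝ) [⋀^Fin k]→ₗ[ℝ] ℝ => G w, rfl⟩, fun _ _ => rfl⟩ :
          ((Fin p → ℝ) [⋀^Fin k]→ₗ[ℝ] ℝ) →+ ℝ) _ _]
    exact Finset.sum_congr rfl fun f _ => mul_comm (F (b ∘ f)) _
  suffices h : A = B by
    rw [← hB w, ← h]
    rfl
  have hinc : ∀ f₀ : Fin k ↪o Fin p, A (b ∘ f₀) = B (b ∘ f₀) := by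
    intro f₀
    rw [hB, Finset.sum_eq_single f₀]
    · have : Function.extend f₀ (b ∘ f₀) b = b := by
        funext a
        by_cases ha : ∃ k, f₀ k = a
        · obtain ⟨k, rfl⟩ := ha
          exact f₀.injective.extend_apply _ _ k
        · exact Function.extend_apply' _ _ _ ha
      rw [this]
      rfl
    · intro f _ hf
      obtain ⟨i, hi⟩ := exists_notMem_range_of_ne hf.symm
      rw [D.map_eq_zero_of_eq (i := f i) (j := f₀ i), zero_mul]
      · rw [f.injective.extend_apply, Function.extend_apply' _ _ _ hi]
        rfl
      · exact fun h => hi ⟨i, h⟩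
    · exact fun h => absurd (Finset.mem_univ _) h
  refine b.ext_alternating fun g hg => ?_
  -- Sorting an injective index family changes both sides by the same sign.
  let f₀ : Fin k ↪o Fin p := OrderEmbedding.ofStrictMono (g ∘ Tuple.sort g)
    ((Tuple.monotone_sort g).strictMono_of_injective (hg.comp (Tuple.sort g).injective))
  have h := hinc f₀
  have hA := A.map_perm (b ∘ g) (Tuple.sort g)
  have hB' := B.map_perm (b ∘ g) (Tuple.sort g)
  have he : b ∘ f₀ = (b ∘ g) ∘ Tuple.sort g := rfl
  rw [he, hA, hB'] at h
  exact smul_left_cancel _ h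

/-- Sylvester's exchange identity. -/
theorem det_mul_alternating (F : (Fin p → ℝ) [⋀^Fin k]→ₗ[ℝ] ℝ)
    (v : Fin p → Fin p → ℝ) (w : Fin k → Fin p → ℝ) :
    Matrix.det (Matrix.of v) * F w = ∑ f : Fin k ↪o Fin p,
      Matrix.det (Matrix.of (Function.extend f w v)) * F (v ∘ f) := by
  -- The perturbation `t + v` has independent rows except at the finitely many roots of the
  -- characteristic polynomial of `-v`. Both sides are continuous in `t`, so the case of a basis
  -- implies the identity at `t = 0`.
  let vt : ℝ → Fin p → Fin p → ℝ := fun t => (Matrix.scalar (Fin p) t - -Matrix.of v)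
  have hvt : ∀ t i, vt t i = fun a => Matrix.scalar (Fin p) t i a + v i a := by
    intro t i
    funext a
    simp [vt]
  have hcont : ∀ i, Continuous fun t => vt t i := by
    intro i
    simp only [hvt]
    refine continuous_pi fun a => Continuous.add ?_ continuous_const
    by_cases h : i = a
    · simpa [h] using continuous_id'
    · simpa [h] using continuous_const
  have hdet : ∀ u : ℝ → Fin p → Fin p → ℝ, (∀ i, Continuous fun t => u t i) →
      Continuous fun t => Matrix.det (Matrix.of (u t)) := fun u hu =>
    Continuous.matrix_det (continuous_pi hu)
  have hF : Continuous F := continuous_multilinearMap F.toMultilinearMap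
  have hdense : Dense {t | Matrix.det (Matrix.of (vt t)) ≠ 0} := by
    have hfin : {t | Matrix.det (Matrix.of (vt t)) = 0}.Finite := by
      refine ((-Matrix.of v).charpoly.roots.toFinset.finite_toSet).subset fun t ht => ?_
      have : (-Matrix.of v).charpoly.eval t = 0 := by
        rw [Matrix.eval_charpoly]
        exact ht
      rw [Finset.mem_coe, Multiset.mem_toFinset, Polynomial.mem_roots']
      exact ⟨(Matrix.charpoly_monic _).ne_zero, this⟩
    exact hfin.countable.dense_compl ℝ
  have key := Continuous.ext_on hdense (f := fun t => Matrix.det (Matrix.of (vt t)) * F w)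
    (g := fun t => ∑ f : Fin k ↪o Fin p,
      Matrix.det (Matrix.of (Function.extend f w (vt t))) * F (vt t ∘ f))
    ((hdet vt hcont).mul continuous_const)
    (continuous_finsetSum _ fun f _ => (hdet _ fun i => ?_).mul
      (hF.comp (continuous_pi fun i => hcont (f i)))) fun t ht => ?_
  · have h := congrFun key 0
    have h0 : vt 0 = v := by
      funext i a
      simp [vt]
    simpa only [h0] using h
  · by_cases hi : ∃ a, f a = i
    · obtain ⟨a, rfl⟩ := hi
      simpa only [f.injective.extend_apply] using continuous_const
    · simpa only [Function.extend_apply' _ _ _ hi] using hcont i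
  · have hli : LinearIndependent ℝ (vt t) :=
      Matrix.linearIndependent_rows_iff_isUnit.2
        ((Matrix.isUnit_iff_isUnit_det _).2 (isUnit_iff_ne_zero.2 ht))
    let b := Module.Basis.mk hli (hli.span_eq_top_of_card_eq_finrank' (by simp)).ge
    have hb : (b : Fin p → Fin p → ℝ) = vt t := Module.Basis.coe_mk _ _
    have := det_mul_alternating_of_basis F b w
    rw [hb] at this
    exact this

end Sylvester

/-! ### Products of column determinants -/

section Determinants

variable {μ : YoungDiagram} {V : Type u} [AddCommGroup V] [Module ℝ V]
  {R : Type v} [CommRing R] [Algebra ℝ R]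

/-- The rows of the matrix of column `j` of a tableau of vectors, with entries read off
by `L`. -/
def colRows (L : V →ₗ[ℝ] ℕ → R) (j : ℕ) (v : Box μ → V) :
    Fin (μ.colLen j) → Fin (μ.colLen j) → R :=
  fun i r => L (v (colBox μ j i)) r

/-- The matrix of column `j` of a tableau of vectors, with entries read off by `L`. -/
def colMatrix (L : V →ₗ[ℝ] ℕ → R) (j : ℕ) (v : Box μ → V) :
    Matrix (Fin (μ.colLen j)) (Fin (μ.colLen j)) R :=
  Matrix.of (colRows L j v)

/-- The product of the column determinants of a tableau of vectors. -/
noncomputable def tabDet (L : V →ₗ[ℝ] ℕ → R) (v : Box μ → V) : R :=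
  ∏ j : Fin (μ.rowLen 0), (colMatrix L j v).det

theorem col_lt_rowLen (c : Box μ) : c.1.2 < μ.rowLen 0 :=
  YoungDiagram.mem_iff_lt_rowLen.1
    (μ.up_left_mem (Nat.zero_le _) le_rfl ((YoungDiagram.mem_cells _).1 c.2))

theorem colMatrix_congr (L : V →ₗ[ℝ] ℕ → R) {j : ℕ} {v v' : Box μ → V}
    (h : ∀ c : Box μ, c.1.2 = j → v c = v' c) : colMatrix L j v = colMatrix L j v' := by
  ext i r
  simp only [colMatrix, colRows, Matrix.of_apply, h _ (colBox_col j i)]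

theorem colMatrix_update [DecidableEq (Box μ)] (L : V →ₗ[ℝ] ℕ → R) (j : ℕ) (i : Fin (μ.colLen j)) (v : Box μ → V)
    (x : V) : colMatrix L j (Function.update v (colBox μ j i) x) =
      (colMatrix L j v).updateRow i fun r => L x r := by
  ext a r
  by_cases h : a = i
  · subst h
    simp [colMatrix, colRows]
  · simp [colMatrix, colRows, h, (colBox_injective j).ne h]

/-- Only the determinant of the column containing `c` sees the entry at `c`, through a single row;
the other columns contribute the constant `a`. -/
theorem tabDet_update [DecidableEq (Box μ)] (L : V →ₗ[ℝ] ℕ → R) (v : Box μ → V) (c : Box μ) : ∃ (i : _) (a : R),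
    ∀ x, tabDet L (Function.update v c x) =
      ((colMatrix L c.1.2 v).updateRow i fun r => L x r).det * a := by
  obtain ⟨i, hi⟩ := exists_colBox_eq c
  refine ⟨i, ∏ j ∈ Finset.univ.erase (⟨c.1.2, col_lt_rowLen c⟩ : Fin (μ.rowLen 0)),
    (colMatrix L j v).det, fun x => ?_⟩
  rw [tabDet, ← Finset.mul_prod_erase _ _ (Finset.mem_univ ⟨c.1.2, col_lt_rowLen c⟩),
    ← colMatrix_update, hi]
  refine congrArg _ (Finset.prod_congr rfl fun j hj => congrArg _ (colMatrix_congr L fun d hd => ?_))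
  refine Function.update_of_ne ?_ _ _
  rintro rfl
  exact Finset.ne_of_mem_erase hj (Fin.ext hd.symm)

/-- The product of the column determinants as a multilinear map. -/
noncomputable def tabDetMultilinear (L : V →ₗ[ℝ] ℕ → R) :
    MultilinearMap ℝ (fun _ : Box μ => V) R where
  toFun := tabDet L
  map_update_add' v c x y := by
    obtain ⟨i, a, h⟩ := tabDet_update L v c
    have hxy : (fun r : Fin (μ.colLen c.1.2) => L (x + y) r) =
        (fun r : Fin (μ.colLen c.1.2) => L x r) + fun r : Fin (μ.colLen c.1.2) => L y r := by
      funext r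
      simp
    rw [h, h, h, hxy, Matrix.det_updateRow_add, add_mul]
  map_update_smul' v c t x := by
    obtain ⟨i, a, h⟩ := tabDet_update L v c
    have hx : (fun r : Fin (μ.colLen c.1.2) => L (t • x) r) =
        algebraMap ℝ R t • fun r : Fin (μ.colLen c.1.2) => L x r := by
      funext r
      simp [Algebra.smul_def]
    rw [h, h, hx, Matrix.det_updateRow_smul, Algebra.smul_def, mul_assoc]

theorem tabDet_eq_zero (L : V →ₗ[ℝ] ℕ → R) {v : Box μ → V} {b b' : Box μ} (hb : b ≠ b')
    (hc : b.1.2 = b'.1.2) (hv : v b = v b') : tabDet L v = 0 := by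
  obtain ⟨i, hi⟩ := exists_colBox_eq b
  obtain ⟨i', hi'⟩ : ∃ i', colBox μ b.1.2 i' = b' := by
    rw [hc]
    exact exists_colBox_eq b'
  refine Finset.prod_eq_zero (Finset.mem_univ (⟨b.1.2, col_lt_rowLen b⟩ : Fin (μ.rowLen 0))) ?_
  refine Matrix.det_zero_of_row_eq (i := i) (j := i') ?_ ?_
  · rintro rfl
    exact hb (hi.symm.trans hi')
  · funext r
    simp only [colMatrix, colRows, Matrix.of_apply, hi, hi', hv]

theorem map_tabDet {S : Type w} [CommRing S] [Algebra ℝ S] (φ : R →+* S) (L : V →ₗ[ℝ] ℕ → R)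
    (L' : V →ₗ[ℝ] ℕ → S) (h : ∀ x r, φ (L x r) = L' x r) (v : Box μ → V) :
    φ (tabDet L v) = tabDet L' v := by
  rw [tabDet, map_prod, tabDet]
  refine Finset.prod_congr rfl fun j _ => ?_
  rw [RingHom.map_det]
  congr 1
  ext i r
  exact h _ _

/-- The product of the column determinants satisfies the exchange relations. -/
theorem tabDet_exchange (L : V →ₗ[ℝ] ℕ → ℝ) {j₁ j₂ : ℕ} (hj : j₁ < j₂) {k : ℕ}
    (g : Fin k ↪o Fin (μ.colLen j₂)) (v : Box μ → V) :
    tabDet L v = ∑ f : Fin k ↪o Fin (μ.colLen j₁), tabDet L (exchange v f g) := by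
  -- For `k = 0` the columns may be empty and lie outside the diagram; the only exchange is then
  -- trivial. For `k > 0` both columns occur in the product.
  rcases Nat.eq_zero_or_pos k with rfl | hk
  · have : Unique (Fin 0 ↪o Fin (μ.colLen j₁)) :=
      { default := RelEmbedding.ofIsEmpty _ _, uniq := fun f => by ext i; exact i.elim0 }
    rw [Fintype.sum_unique]
    congr 1
    funext c
    exact (exchange_of_ne v _ g (fun i => i.elim0) fun i => i.elim0).symm
  have hj₂ : j₂ < μ.rowLen 0 := col_lt_rowLen (colBox μ j₂ (g ⟨0, hk⟩))
  have hj₁ : j₁ < μ.rowLen 0 := hj.trans hj₂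
  have hne : (⟨j₂, hj₂⟩ : Fin (μ.rowLen 0)) ∈ Finset.univ.erase (⟨j₁, hj₁⟩ : Fin (μ.rowLen 0)) :=
    Finset.mem_erase.2 ⟨fun h => hj.ne' (congrArg Fin.val h), Finset.mem_univ _⟩
  have hsplit : ∀ u : Box μ → V, tabDet L u = (colMatrix L j₁ u).det * ((colMatrix L j₂ u).det *
      ∏ j ∈ (Finset.univ.erase (⟨j₁, hj₁⟩ : Fin (μ.rowLen 0))).erase ⟨j₂, hj₂⟩,
        (colMatrix L j u).det) := fun u => by
    rw [tabDet, ← Finset.mul_prod_erase _ _ (Finset.mem_univ (⟨j₁, hj₁⟩ : Fin (μ.rowLen 0))),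
      ← Finset.mul_prod_erase _ _ hne]
  have hrest : ∀ f : Fin k ↪o Fin (μ.colLen j₁),
      ∏ j ∈ (Finset.univ.erase (⟨j₁, hj₁⟩ : Fin (μ.rowLen 0))).erase ⟨j₂, hj₂⟩,
        (colMatrix L j (exchange v f g)).det =
      ∏ j ∈ (Finset.univ.erase (⟨j₁, hj₁⟩ : Fin (μ.rowLen 0))).erase ⟨j₂, hj₂⟩,
        (colMatrix L j v).det := by
    intro f
    refine Finset.prod_congr rfl fun j hj' => congrArg _ (colMatrix_congr L fun c hc => ?_)
    have h₂ := Finset.ne_of_mem_erase hj'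
    have h₁ := Finset.ne_of_mem_erase (Finset.mem_of_mem_erase hj')
    refine exchange_of_ne v f g (fun i hi => h₁ (Fin.ext ?_)) fun i hi => h₂ (Fin.ext ?_)
    · rw [← hc, ← hi, colBox_col]
    · rw [← hc, ← hi, colBox_col]
  -- the rows of the longer column, and the truncation to the length of the shorter one
  let row : V → Fin (μ.colLen j₁) → ℝ := fun x r => L x r
  have hlen : μ.colLen j₂ ≤ μ.colLen j₁ := μ.colLen_anti _ _ hj.le
  let tr : (Fin (μ.colLen j₁) → ℝ) →ₗ[ℝ] Fin (μ.colLen j₂) → ℝ :=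
    LinearMap.funLeft ℝ ℝ (Fin.castLE hlen)
  -- The right column's determinant as a function of the rows placed in the chosen boxes. Rows of
  -- the longer left column enter truncated, so Sylvester's identity for the left matrix applies to
  -- this `F`.
  let F : (Fin (μ.colLen j₁) → ℝ) [⋀^Fin k]→ₗ[ℝ] ℝ :=
    (alternatingExtend Matrix.detRowAlternating g.toEmbedding (colRows L j₂ v)).compLinearMap tr
  have h₁ : ∀ f : Fin k ↪o Fin (μ.colLen j₁), colRows L j₁ (exchange v f g) =
      Function.extend f (fun i => row (v (colBox μ j₂ (g i)))) (colRows L j₁ v) := by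
    intro f
    funext a
    by_cases ha : ∃ i, f i = a
    · obtain ⟨i, rfl⟩ := ha
      rw [f.injective.extend_apply]
      unfold colRows
      simp only [exchange_left, row]
    · rw [Function.extend_apply' _ _ _ ha]
      unfold colRows
      rw [exchange_of_ne v f g (fun i hi => ha ⟨i, colBox_injective _ hi⟩)
        fun i => (colBox_ne hj.ne _ _).symm]
  have h₂ : ∀ f : Fin k ↪o Fin (μ.colLen j₁),
      (colMatrix L j₂ (exchange v f g)).det = F (colRows L j₁ v ∘ f) := by
    intro f
    have : colRows L j₂ (exchange v f g) =
        Function.extend g (fun i => tr (colRows L j₁ v (f i))) (colRows L j₂ v) := by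
      funext a
      by_cases ha : ∃ i, g i = a
      · obtain ⟨i, rfl⟩ := ha
        rw [g.injective.extend_apply]
        unfold colRows
        simp only [exchange_right v f g hj.ne]
        rfl
      · rw [Function.extend_apply' _ _ _ ha]
        unfold colRows
        rw [exchange_of_ne v f g (fun i => colBox_ne hj.ne _ _)
          fun i hi => ha ⟨i, colBox_injective _ hi⟩]
    rw [colMatrix, this]
    rfl
  have h₀ : (colMatrix L j₂ v).det = F fun i => row (v (colBox μ j₂ (g i))) := by
    have : colRows L j₂ v =
        Function.extend g (fun i => tr (row (v (colBox μ j₂ (g i))))) (colRows L j₂ v) := by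
      funext a
      by_cases ha : ∃ i, g i = a
      · obtain ⟨i, rfl⟩ := ha
        rw [g.injective.extend_apply]
        rfl
      · rw [Function.extend_apply' _ _ _ ha]
    rw [colMatrix, this]
    rfl
  have key := det_mul_alternating F (colRows L j₁ v) fun i => row (v (colBox μ j₂ (g i)))
  rw [hsplit v, h₀, ← mul_assoc]
  have h₁' : ∀ f : Fin k ↪o Fin (μ.colLen j₁), (colMatrix L j₁ (exchange v f g)).det =
      (Matrix.of (Function.extend f (fun i => row (v (colBox μ j₂ (g i)))) (colRows L j₁ v))).det :=
    fun f => by rw [colMatrix, h₁]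
  simp only [hsplit (exchange _ _ _), hrest, h₁', h₂, ← mul_assoc, ← Finset.sum_mul]
  exact congrArg (· * _) key

end Determinants

/-! ### Linear independence of the semistandard tableaux -/

section Independence

variable {μ : YoungDiagram} {m : ℕ} {V : Type u} [AddCommGroup V] [Module ℝ V]

/-- The generic linear map, sending the basis vector `b s` to the family of variables
`X (r, s)`. -/
noncomputable def genericMap (b : Module.Basis (Fin m) ℝ V) :
    V →ₗ[ℝ] ℕ → MvPolynomial (ℕ × Fin m) ℝ :=
  b.constr ℝ fun s r => MvPolynomial.X (r, s)

/-- The exchange identity is available over `ℝ`; a polynomial identity may be checked at all real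
points. -/
theorem tabDet_genericMap_exchangeAxioms (b : Module.Basis (Fin m) ℝ V) :
    ExchangeAxioms μ (tabDetMultilinear (μ := μ) (genericMap b)) where
  alternating v c c' hc hcc hv := tabDet_eq_zero _ hc hcc hv
  exchange j₁ j₂ hj k g v := by
    refine MvPolynomial.funext fun Z => ?_
    rw [map_sum]
    let φ : MvPolynomial (ℕ × Fin m) ℝ →ₐ[ℝ] ℝ := MvPolynomial.aeval Z
    let L : V →ₗ[ℝ] ℕ → ℝ :=
      LinearMap.pi fun r => φ.toLinearMap ∘ₗ LinearMap.proj r ∘ₗ genericMap b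
    have h : ∀ u : Box μ → V,
        MvPolynomial.eval Z (tabDetMultilinear (genericMap b) u) = tabDet L u := fun u =>
      map_tabDet (MvPolynomial.eval Z) (genericMap b) L (fun x r => rfl) u
    simp only [h]
    exact tabDet_exchange L hj g v

/-- A column permutation is a family of permutations of the columns. -/
abbrev ColPerm (μ : YoungDiagram) : Type := ∀ j : Fin (μ.rowLen 0), Equiv.Perm (Fin (μ.colLen j))

/-- The exponent of the monomial of the filling `T` belonging to a column permutation. -/
noncomputable def colExponent (σ : ColPerm μ) (T : Box μ → Fin m) : ℕ × Fin m →₀ ℕ :=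
  ∑ j : Fin (μ.rowLen 0), ∑ i, Finsupp.single ((σ j i : ℕ), T (colBox μ j i)) 1

theorem tabDet_genericMap (b : Module.Basis (Fin m) ℝ V) (T : Box μ → Fin m) :
    tabDet (genericMap b) (b ∘ T) = ∑ σ : ColPerm μ,
      MvPolynomial.monomial (colExponent σ T) (∏ j, ((Equiv.Perm.sign (σ j) : ℤ) : ℝ)) := by
  have hcol : ∀ j, (colMatrix (genericMap b) j (b ∘ T)).det =
      ∑ σ : Equiv.Perm (Fin (μ.colLen j)), MvPolynomial.monomial
        (∑ i, Finsupp.single ((σ i : ℕ), T (colBox μ j i)) 1)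
        ((Equiv.Perm.sign σ : ℤ) : ℝ) := by
    intro j
    rw [← Matrix.det_transpose, Matrix.det_apply]
    refine Finset.sum_congr rfl fun σ _ => ?_
    have hprod : ∏ i, (colMatrix (genericMap b) j (b ∘ T)).transpose (σ i) i =
        MvPolynomial.monomial (∑ i, Finsupp.single ((σ i : ℕ), T (colBox μ j i)) 1) (1 : ℝ) := by
      rw [MvPolynomial.monomial_sum_one]
      refine Finset.prod_congr rfl fun i _ => ?_
      change genericMap b (b (T (colBox μ j i))) (σ i : ℕ) = _
      rw [genericMap, b.constr_basis]
      rfl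
    rw [hprod, Units.smul_def, ← Int.cast_smul_eq_zsmul ℝ, MvPolynomial.smul_monomial, smul_eq_mul,
      mul_one]
  rw [tabDet]
  simp only [hcol]
  rw [Finset.prod_univ_sum, Fintype.piFinset_univ]
  exact Finset.sum_congr rfl fun σ _ => (MvPolynomial.monomial_sum_prod _ _ _).symm

theorem sum_box {A : Type*} [AddCommMonoid A] (F : Box μ → A) :
    ∑ c, F c = ∑ j : Fin (μ.rowLen 0), ∑ i, F (colBox μ j i) := by
  rw [← Fintype.sum_sigma' fun (j : Fin (μ.rowLen 0)) i => F (colBox μ j i)]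
  refine (Fintype.sum_bijective (fun x : Σ j : Fin (μ.rowLen 0), Fin (μ.colLen j) =>
    colBox μ x.1 x.2) ⟨?_, fun c => ?_⟩ _ _ fun _ => rfl).symm
  · rintro ⟨j, i⟩ ⟨j', i'⟩ h
    obtain rfl : j = j' := Fin.ext (congrArg (fun c : Box μ => c.1.2) h)
    rw [colBox_injective (μ := μ) (j : ℕ) (show colBox μ j i = colBox μ j i' from h)]
  · obtain ⟨i, hi⟩ := exists_colBox_eq c
    exact ⟨⟨⟨c.1.2, col_lt_rowLen c⟩, i⟩, hi⟩

/-- The weight of an exponent in which the variable `X (r, s)` has weight `r * s`. -/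
noncomputable def expWeight : (ℕ × Fin m →₀ ℕ) →+ ℤ :=
  Finsupp.weight fun x : ℕ × Fin m => (x.1 : ℤ) * ((x.2 : ℕ) : ℤ)

theorem expWeight_colExponent (σ : ColPerm μ) (T : Box μ → Fin m) :
    expWeight (colExponent σ T) =
      ∑ j : Fin (μ.rowLen 0), ∑ i, ((σ j i : ℕ) : ℤ) * ((T (colBox μ j i) : ℕ) : ℤ) := by
  simp only [colExponent, map_sum, expWeight, Finsupp.weight_single, one_smul]

theorem rowWeight_eq (T : Box μ → Fin m) : rowWeight T =
    ∑ j : Fin (μ.rowLen 0), ∑ i : Fin (μ.colLen j), ((i : ℕ) : ℤ) * ((T (colBox μ j i) : ℕ) : ℤ) :=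
  sum_box _

theorem strictMono_col {T : Box μ → Fin m} (hT : IsSemistandard T) (j : ℕ) :
    StrictMono fun i => ((T (colBox μ j i) : ℕ) : ℤ) := fun _ _ hab =>
  Int.ofNat_lt.2 (Fin.lt_def.1 (hT.col _ _ rfl (Fin.lt_def.1 hab)))

theorem monovary_coe_of_strictMono {n : ℕ} {t : Fin n → ℤ} (ht : StrictMono t) :
    Monovary (fun i : Fin n => ((i : ℕ) : ℤ)) t := fun _ _ hab =>
  Int.ofNat_le.2 (Fin.le_def.1 (ht.lt_iff_lt.1 hab).le)

/-- Rearrangement inequality in each column: entries increase downwards, so pairing them with row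
indices in order gives the largest weight. -/
theorem expWeight_colExponent_le {T : Box μ → Fin m} (hT : IsSemistandard T) (σ : ColPerm μ) :
    expWeight (colExponent σ T) ≤ rowWeight T := by
  rw [expWeight_colExponent, rowWeight_eq]
  exact Finset.sum_le_sum fun j _ =>
    (monovary_coe_of_strictMono (strictMono_col hT j)).sum_comp_perm_mul_le_sum_mul

/-- Equality in the rearrangement inequality forces each column permutation to be monotone, as the
entries are strictly increasing. -/
theorem eq_one_of_expWeight_eq {T : Box μ → Fin m} (hT : IsSemistandard T) {σ : ColPerm μ}
    (h : expWeight (colExponent σ T) = rowWeight T) : σ = 1 := by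
  rw [expWeight_colExponent, rowWeight_eq] at h
  have hmv := fun j => monovary_coe_of_strictMono (strictMono_col hT j)
  have h' := (Finset.sum_eq_sum_iff_of_le fun (j : Fin (μ.rowLen 0)) _ =>
    (hmv j).sum_comp_perm_mul_le_sum_mul (σ := σ j)).1 h
  funext j
  have hm := (hmv j).sum_comp_perm_mul_eq_sum_mul_iff.1 (h' j (Finset.mem_univ j))
  have hmono : StrictMono (σ j) := by
    refine Monotone.strictMono_of_injective (fun a b hab => ?_) (σ j).injective
    rcases hab.eq_or_lt with rfl | hab
    · exact le_rfl
    · exact Fin.le_def.2 (Int.ofNat_le.1 (hm (strictMono_col hT j hab)))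
  exact Equiv.ext fun i => le_antisymm hmono.apply_le hmono.le_apply

theorem colExponent_one (T : Box μ → Fin m) :
    colExponent 1 T = ∑ c : Box μ, Finsupp.single (c.1.1, T c) 1 :=
  (sum_box fun c => Finsupp.single (c.1.1, T c) 1).symm

theorem colExponent_one_apply (T : Box μ → Fin m) (r : ℕ) (s : Fin m) :
    colExponent 1 T (r, s) = (Finset.univ.filter fun c : Box μ => c.1.1 = r ∧ T c = s).card := by
  rw [colExponent_one, Finsupp.finsetSum_apply, Finset.card_filter]
  refine Finset.sum_congr rfl fun c _ => ?_
  rw [Finsupp.single_apply]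
  simp only [Prod.mk.injEq]

/-- The box in column `j` of row `i`. -/
def rowBox (μ : YoungDiagram) (i : ℕ) (j : Fin (μ.rowLen i)) : Box μ :=
  ⟨(i, (j : ℕ)), (YoungDiagram.mem_cells _).2 (YoungDiagram.mem_iff_lt_rowLen.2 j.2)⟩

theorem rowBox_injective (i : ℕ) : Function.Injective (rowBox μ i) := fun _ _ h =>
  Fin.ext (congrArg (fun c : Box μ => c.1.2) h)

theorem exists_rowBox_eq (c : Box μ) : ∃ j, rowBox μ c.1.1 j = c :=
  ⟨⟨c.1.2, YoungDiagram.mem_iff_lt_rowLen.1 ((YoungDiagram.mem_cells _).1 c.2)⟩, rfl⟩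

/-- A semistandard filling is determined by its diagonal monomial. -/
theorem eq_of_colExponent_one_eq {S T : Box μ → Fin m} (hS : IsSemistandard S)
    (hT : IsSemistandard T) (h : colExponent 1 S = colExponent 1 T) : S = T := by
  have hmono : ∀ {U : Box μ → Fin m}, IsSemistandard U → ∀ i,
      Monotone fun j => U (rowBox μ i j) := fun {U} hU i a b hab =>
    hab.eq_or_lt.elim (fun h => h ▸ le_rfl) fun h => hU.row _ _ rfl (Fin.lt_def.1 h)
  -- The exponent of `X (i, s)` counts the occurrences of `s` in row `i`. A weakly increasing row is
  -- the sorted list of its entries, so these counts recover it.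
  have hcount : ∀ (U : Box μ → Fin m) (i : ℕ) (s : Fin m),
      Multiset.count s (Multiset.map (fun j => U (rowBox μ i j)) Finset.univ.val) =
        colExponent 1 U (i, s) := by
    intro U i s
    rw [colExponent_one_apply, Multiset.count_map, ← Finset.filter_val, Finset.card_val,
      ← Finset.card_map ⟨_, rowBox_injective i⟩]
    congr 1
    ext c
    simp only [Finset.mem_map, Finset.mem_filter, Finset.mem_univ, true_and,
      Function.Embedding.coeFn_mk]
    constructor
    · rintro ⟨j, hj, rfl⟩
      exact ⟨rfl, hj.symm⟩
    · rintro ⟨rfl, hs⟩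
      obtain ⟨j, hj⟩ := exists_rowBox_eq c
      exact ⟨j, by rw [hj, hs], hj⟩
  funext c
  have hperm : (List.ofFn fun j => S (rowBox μ c.1.1 j)).Perm
      (List.ofFn fun j => T (rowBox μ c.1.1 j)) := by
    rw [← Multiset.coe_eq_coe, ← Fin.univ_val_map, ← Fin.univ_val_map]
    exact Multiset.ext.2 fun s => by rw [hcount, hcount, h]
  have heq := hperm.eq_of_sortedLE (hmono hS _).sortedLE_ofFn (hmono hT _).sortedLE_ofFn
  obtain ⟨j, hj⟩ := exists_rowBox_eq c
  have := congrFun (List.ofFn_injective heq) j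
  rwa [hj] at this

/-- Every monomial for `S` has weight at most `rowWeight S`, with equality only for the identity
column permutation. Under `hle` only the diagonal monomial of `S` can match that of `T`. -/
theorem coeff_tabDet {S T : Box μ → Fin m} (hS : IsSemistandard S) (hT : IsSemistandard T)
    (hle : rowWeight S ≤ rowWeight T) (b : Module.Basis (Fin m) ℝ V) :
    MvPolynomial.coeff (colExponent 1 T) (tabDet (genericMap b) (b ∘ S)) =
      if S = T then 1 else 0 := by
  classical
  have hσ : ∀ σ : ColPerm μ, colExponent σ S = colExponent 1 T → σ = 1 := by
    intro σ h
    refine eq_one_of_expWeight_eq hS (le_antisymm (expWeight_colExponent_le hS σ) ?_)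
    have h1 : expWeight (colExponent 1 T) = rowWeight T := by
      rw [expWeight_colExponent, rowWeight_eq]
      rfl
    rwa [h, h1]
  rw [tabDet_genericMap, MvPolynomial.coeff_sum, Finset.sum_eq_single 1]
  · rw [MvPolynomial.coeff_monomial]
    by_cases hST : S = T
    · subst hST
      simp
    · rw [if_neg hST, if_neg fun h => hST (eq_of_colExponent_one_eq hS hT h)]
  · intro σ _ h
    rw [MvPolynomial.coeff_monomial, if_neg fun h' => h (hσ σ h')]
  · exact fun h => absurd (Finset.mem_univ _) h

/-- It suffices to work in the polynomial ring. In a nontrivial relation, the diagonal monomial of a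
tableau of maximal `rowWeight` among those with nonzero coefficient has precisely that coefficient.
-/
theorem linearIndependent_semistandard (b : Module.Basis (Fin m) ℝ V) :
    LinearIndependent ℝ fun T : {T : Box μ → Fin m // IsSemistandard T} =>
      schurH μ V (b ∘ T.1) := by
  classical
  refine LinearIndependent.of_comp (schurLift μ _ (tabDet_genericMap_exchangeAxioms b)) ?_
  have := Fintype.ofFinite {T : Box μ → Fin m // IsSemistandard T}
  rw [Fintype.linearIndependent_iff]
  intro g hg
  by_contra! hne
  obtain ⟨T₀, hT₀⟩ := hne
  obtain ⟨T, hT, hmax⟩ := Finset.exists_max_image (Finset.univ.filter fun T => g T ≠ 0)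
    (fun T => rowWeight T.1) ⟨T₀, by simpa using hT₀⟩
  simp only [Finset.mem_filter, Finset.mem_univ, true_and] at hT hmax
  have h := congrArg (MvPolynomial.coeff (colExponent 1 T.1)) hg
  rw [MvPolynomial.coeff_sum, Finset.sum_eq_single T] at h
  · rw [MvPolynomial.coeff_smul, Function.comp_apply, schurLift_schurH] at h
    rw [show tabDetMultilinear (genericMap b) (b ∘ T.1) = tabDet (genericMap b) (b ∘ T.1) from rfl,
      coeff_tabDet T.2 T.2 le_rfl b, if_pos rfl] at h
    exact hT (by simpa using h)
  · intro S _ hST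
    by_cases hS : g S = 0
    · rw [hS, zero_smul, MvPolynomial.coeff_zero]
    · rw [MvPolynomial.coeff_smul, Function.comp_apply, schurLift_schurH,
        show tabDetMultilinear (genericMap b) (b ∘ S.1) = tabDet (genericMap b) (b ∘ S.1) from rfl,
        coeff_tabDet S.2 T.2 (hmax S hS) b, if_neg fun h => hST (Subtype.ext h), smul_zero]
  · exact fun h => absurd (Finset.mem_univ _) h

/-- Semistandard fillings with entries in `Fin m` are the semistandard tableaux with entries in
`{1, …, m}`. -/
def semistandardEquiv (μ : YoungDiagram) (m : ℕ) :
    {T : Box μ → Fin m // IsSemistandard T} ≃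
      {T : SemistandardYoungTableau μ | ∀ i j, (i, j) ∈ μ → T i j ∈ Finset.Icc 1 m} where
  toFun T := ⟨{
    -- Shift by one: `Fin m` starts at zero, while zero is the value prescribed outside the diagram.
    entry i j := if h : (i, j) ∈ μ then (T.1 ⟨(i, j), (YoungDiagram.mem_cells _).2 h⟩ : ℕ) + 1
      else 0
    row_weak' {i j₁ j₂} hj h := by
      rw [dif_pos h, dif_pos (μ.up_left_mem le_rfl hj.le h)]
      exact Nat.succ_le_succ (Fin.le_def.1 (T.2.row ⟨(i, j₁), _⟩ ⟨(i, j₂), _⟩ rfl hj))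
    col_strict' {i₁ i₂ j} hi h := by
      rw [dif_pos h, dif_pos (μ.up_left_mem hi.le le_rfl h)]
      exact Nat.succ_lt_succ (Fin.lt_def.1 (T.2.col ⟨(i₁, j), _⟩ ⟨(i₂, j), _⟩ rfl hi))
    zeros' h := dif_neg h }, fun i j h => by
      rw [← SemistandardYoungTableau.to_fun_eq_coe]
      simp only [dif_pos h, Finset.mem_Icc]
      exact ⟨Nat.succ_pos _, Fin.isLt _⟩⟩
  invFun T := ⟨fun c => ⟨T.1 c.1.1 c.1.2 - 1, by
      have := Finset.mem_Icc.1 (T.2 c.1.1 c.1.2 ((YoungDiagram.mem_cells _).1 c.2))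
      lia⟩, by
    refine ⟨fun c c' h₁ h₂ => Fin.le_def.2 ?_, fun c c' h₁ h₂ => Fin.lt_def.2 ?_⟩
    · have := T.1.row_weak (i := c'.1.1) h₂ ((YoungDiagram.mem_cells _).1 c'.2)
      dsimp only
      rw [h₁]
      exact Nat.sub_le_sub_right this 1
    · have := T.1.col_strict (j := c'.1.2) h₂ ((YoungDiagram.mem_cells _).1 c'.2)
      have h0 := Finset.mem_Icc.1 (T.2 c.1.1 c.1.2 ((YoungDiagram.mem_cells _).1 c.2))
      dsimp only
      rw [h₁] at h0 ⊢
      lia⟩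
  left_inv T := by
    refine Subtype.ext (funext fun c => Fin.ext ?_)
    change (if h : (c.1.1, c.1.2) ∈ μ then
      (T.1 ⟨(c.1.1, c.1.2), (YoungDiagram.mem_cells _).2 h⟩ : ℕ) + 1 else 0) - 1 = _
    rw [dif_pos ((YoungDiagram.mem_cells _).1 c.2)]
    rfl
  right_inv T := by
    refine Subtype.ext (SemistandardYoungTableau.ext fun i j => ?_)
    change (if h : (i, j) ∈ μ then (T.1 i j - 1) + 1 else 0) = T.1 i j
    by_cases h : (i, j) ∈ μ
    · rw [dif_pos h]
      have := Finset.mem_Icc.1 (T.2 i j h)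
      lia
    · rw [dif_neg h, T.1.zeros h]

theorem finrank_schurModule (μ : YoungDiagram) (b : Module.Basis (Fin m) ℝ V) :
    Module.finrank ℝ (SchurModule μ V) =
      {T : SemistandardYoungTableau μ | ∀ i j, (i, j) ∈ μ → T i j ∈ Finset.Icc 1 m}.ncard := by
  have hspan : ⊤ ≤ Submodule.span ℝ (Set.range
      fun T : {T : Box μ → Fin m // IsSemistandard T} => schurH μ V (b ∘ T.1)) := by
    rw [← span_semistandard_eq_top b, Set.image_eq_range]
    rfl
  rw [Module.finrank_eq_nat_card_basis
    (Module.Basis.mk (linearIndependent_semistandard (μ := μ) b) hspan),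
    Nat.card_congr (semistandardEquiv μ m)]
  rfl

end Independence

/-! ### Convex bodies -/

theorem span_schurSet {μ : YoungDiagram} {V : Type u} [AddCommGroup V] [Module ℝ V] {P : Set V}
    (hP : Submodule.span ℝ P = ⊤) : Submodule.span ℝ (schurSet μ P) = ⊤ := by
  rw [eq_top_iff, ← span_range_schurH μ, Submodule.span_le]
  rintro _ ⟨v, rfl⟩
  refine multilinear_mem_of_span _ (A := P) (fun v hv => ?_) fun c => by
    rw [hP]; trivial
  exact Submodule.subset_span (subset_convexHull ℝ _ ⟨v, fun c _ => hv c, rfl⟩)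

section Body

variable {μ : YoungDiagram} {V : Type u} [AddCommGroup V] [Module ℝ V]
  [FiniteDimensional ℝ V] [TopologicalSpace V] [IsModuleTopology ℝ V] {P : Set V}

theorem isConvexBody_schurSet (hμ : 0 < μ.card) (hP : IsCompactConvexZero P) (hb : IsConvexBody P) :
    IsConvexBody (schurSet μ P) where
  isCompact := (isCompactConvexZero_schurSet μ hμ hP).isCompact
  convex := (isCompactConvexZero_schurSet μ hμ hP).convex
  interior_nonempty := interior_nonempty_of_span_eq_top (convex_convexHull ℝ _)
    (isCompactConvexZero_schurSet μ hμ hP).zero_mem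
    (span_schurSet (span_eq_top_of_interior_nonempty hb.interior_nonempty))

theorem finrank_vectorSpan_schurSet (hμ : 0 < μ.card) (hP : IsCompactConvexZero P) (hb : IsConvexBody P) :
    Module.finrank ℝ (vectorSpan ℝ (schurSet μ P)) =
      {T : SemistandardYoungTableau μ | ∀ i j, (i, j) ∈ μ →
        T i j ∈ Finset.Icc 1 (Module.finrank ℝ V)}.ncard := by
  rw [vectorSpan_eq_span_of_zero_mem (isCompactConvexZero_schurSet μ hμ hP).zero_mem,
    span_schurSet (span_eq_top_of_interior_nonempty hb.interior_nonempty), finrank_top,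
    finrank_schurModule μ (Module.finBasis ℝ V)]

end Body

/-! ### Linear matrix inequalities -/

theorem posSemidef_iff_sum {n : Type*} [Fintype n] {M : Matrix n n ℝ} :
    M.PosSemidef ↔ M.IsSymm ∧ ∀ c : n → ℝ, 0 ≤ ∑ i, ∑ j, c i * c j * M i j := by
  rw [Matrix.posSemidef_iff_dotProduct_mulVec]
  rw [Matrix.IsHermitian, Matrix.conjTranspose_eq_transpose_of_trivial]
  refine and_congr Iff.rfl (forall_congr' fun c => ?_)
  simp only [dotProduct, Matrix.mulVec, star_trivial, Finset.mul_sum]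
  simp only [mul_comm, mul_left_comm]

theorem posSemidef_fromBlocks_diagonal {n κ : Type*} [Fintype n] [Fintype κ] [DecidableEq κ]
    {Z : Matrix n n ℝ} {d : κ → ℝ} :
    (Matrix.fromBlocks Z 0 0 (Matrix.diagonal d)).PosSemidef ↔
      Z.PosSemidef ∧ ∀ i, 0 ≤ d i := by
  constructor
  · intro h
    refine ⟨h.submatrix Sum.inl, ?_⟩
    have := h.submatrix Sum.inr
    exact Matrix.posSemidef_diagonal_iff.1 this
  · rintro ⟨hZ, hd⟩
    rw [posSemidef_iff_sum] at hZ ⊢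
    refine ⟨Matrix.IsSymm.fromBlocks hZ.1 rfl (Matrix.isSymm_diagonal d), fun c => ?_⟩
    simp only [Fintype.sum_sum_type, Matrix.fromBlocks_apply₁₁, Matrix.fromBlocks_apply₁₂,
      Matrix.fromBlocks_apply₂₁, Matrix.fromBlocks_apply₂₂, Matrix.zero_apply, mul_zero,
      Finset.sum_const_zero, add_zero, zero_add]
    refine add_nonneg (hZ.2 _) (Finset.sum_nonneg fun i _ => Finset.sum_nonneg fun j _ => ?_)
    by_cases hij : i = j
    · subst hij
      rw [Matrix.diagonal_apply_eq]
      exact mul_nonneg (mul_self_nonneg _) (hd i)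
    · rw [Matrix.diagonal_apply_ne _ hij, mul_zero]

section SDR

variable {E : Type u} [AddCommGroup E] [Module ℝ E]

theorem isSDR_of_fintype {n F : Type*} [Fintype n] [AddCommGroup F] [Module ℝ F]
    [FiniteDimensional ℝ F] (A : Matrix n n ℝ) (B : E →ₗ[ℝ] Matrix n n ℝ)
    (C : F →ₗ[ℝ] Matrix n n ℝ) (hA : A.IsSymm) (hB : ∀ x, (B x).IsSymm) (hC : ∀ y, (C y).IsSymm) :
    IsSDR {x | ∃ y, (A + B x + C y).PosSemidef} := by
  classical
  let e := Fintype.equivFin n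
  let r := (Matrix.reindexLinearEquiv ℝ ℝ e e).toLinearMap
  let φ := (Module.finBasis ℝ F).equivFun
  refine ⟨Fintype.card n, Module.finrank ℝ F, r A, r ∘ₗ B, r ∘ₗ C ∘ₗ φ.symm.toLinearMap,
    hA.submatrix _, fun x => (hB x).submatrix _, fun y => (hC _).submatrix _, ?_⟩
  ext x
  have key : ∀ y, (r A + (r ∘ₗ B) x + (r ∘ₗ C ∘ₗ φ.symm.toLinearMap) y).PosSemidef ↔
      (A + B x + C (φ.symm y)).PosSemidef := fun y => by
    have : r A + (r ∘ₗ B) x + (r ∘ₗ C ∘ₗ φ.symm.toLinearMap) y =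
        (A + B x + C (φ.symm y)).submatrix e.symm e.symm := rfl
    rw [this, Matrix.posSemidef_submatrix_equiv]
  simp only [Set.mem_ofPred_eq, key]
  exact ⟨fun ⟨y, hy⟩ => ⟨φ y, by simpa using hy⟩, fun ⟨y, hy⟩ => ⟨_, hy⟩⟩

/-- Sets defined by a linear matrix inequality in auxiliary variables together with finitely many
affine inequalities are projections of spectrahedra. -/
theorem isSDR_of_affine {n κ F : Type*} [Fintype n] [Fintype κ] [AddCommGroup F] [Module ℝ F]
    [FiniteDimensional ℝ F] (Z : F →ₗ[ℝ] Matrix n n ℝ) (hZ : ∀ y, (Z y).IsSymm) (a : κ → ℝ)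
    (β : E →ₗ[ℝ] κ → ℝ) (γ : F →ₗ[ℝ] κ → ℝ) :
    IsSDR {x | ∃ y, (Z y).PosSemidef ∧ ∀ i, 0 ≤ a i + β x i + γ y i} := by
  classical
  let B : E →ₗ[ℝ] Matrix (n ⊕ κ) (n ⊕ κ) ℝ :=
    { toFun x := Matrix.fromBlocks 0 0 0 (Matrix.diagonal (β x))
      map_add' x y := by simp [Matrix.fromBlocks_add]
      map_smul' r x := by simp [Matrix.fromBlocks_smul] }
  let C : F →ₗ[ℝ] Matrix (n ⊕ κ) (n ⊕ κ) ℝ :=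
    { toFun y := Matrix.fromBlocks (Z y) 0 0 (Matrix.diagonal (γ y))
      map_add' x y := by simp [Matrix.fromBlocks_add]
      map_smul' r x := by simp [Matrix.fromBlocks_smul] }
  have h := isSDR_of_fintype (Matrix.fromBlocks 0 0 0 (Matrix.diagonal a)) B C
    (Matrix.IsSymm.fromBlocks (Matrix.isSymm_zero) rfl (Matrix.isSymm_diagonal _))
    (fun x => Matrix.IsSymm.fromBlocks (Matrix.isSymm_zero) rfl (Matrix.isSymm_diagonal _))
    (fun y => Matrix.IsSymm.fromBlocks (hZ y) rfl (Matrix.isSymm_diagonal _))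
  convert h using 5 with x y
  have : Matrix.fromBlocks 0 0 0 (Matrix.diagonal a) + B x + C y =
      Matrix.fromBlocks (Z y) 0 0 (Matrix.diagonal fun i => a i + β x i + γ y i) := by
    simp [B, C, Matrix.fromBlocks_add]
  rw [this, posSemidef_fromBlocks_diagonal]

end SDR

/-! ### Separation by functionals -/

/-- Since `0 ∈ C`, the separating threshold `t` is negative, so the functional can be rescaled to
have threshold `-1`. -/
theorem exists_dual_lt {E : Type u} [AddCommGroup E] [Module ℝ E] [FiniteDimensional ℝ E]
    [TopologicalSpace E] [IsModuleTopology ℝ E] {C : Set E} (hc : Convex ℝ C) (hcl : IsClosed C)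
    (h0 : (0 : E) ∈ C) {y : E} (hy : y ∉ C) :
    ∃ ℓ : Module.Dual ℝ E, ℓ y < -1 ∧ ∀ b ∈ C, -1 ≤ ℓ b := by
  have := IsModuleTopology.topologicalAddGroup ℝ E
  have := locallyConvexSpace_of_isModuleTopology E
  obtain ⟨f, t, hft, hb⟩ := geometric_hahn_banach_point_closed hc hcl hy
  have ht : 0 < -t := by simpa using hb 0 h0
  refine ⟨(-t)⁻¹ • f.toLinearMap, ?_, fun b hbC => ?_⟩
  · change (-t)⁻¹ * f y < -1
    rw [inv_mul_lt_iff₀ ht]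
    linarith
  · change -1 ≤ (-t)⁻¹ * f b
    rw [le_inv_mul_iff₀ ht]
    linarith [hb b hbC]

/-! ### Polars of spectrahedra `1 + ℓ(H) ⪰ 0` -/

section Polar

variable {E : Type u} [AddCommGroup E] [Module ℝ E] {N : ℕ}

/-- The pencil `ℓ ↦ (ℓ (H i j))`. -/
def pencil (H : Fin N → Fin N → E) : Module.Dual ℝ E →ₗ[ℝ] Matrix (Fin N) (Fin N) ℝ where
  toFun ℓ := Matrix.of fun i j => ℓ (H i j)
  map_add' _ _ := rfl
  map_smul' _ _ := rfl

/-- The functionals for which `1 + ℓ(H)` is positive semidefinite. -/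
def pencilSet (H : Fin N → Fin N → E) : Set (Module.Dual ℝ E) :=
  {ℓ | (1 + pencil H ℓ).PosSemidef}

variable {H : Fin N → Fin N → E}

theorem sum_one_add_pencil (H : Fin N → Fin N → E) (ℓ : Module.Dual ℝ E)
    (Z : Matrix (Fin N) (Fin N) ℝ) :
    ∑ i, ∑ j, Z i j * (1 + pencil H ℓ) i j = Z.trace + ℓ (∑ i, ∑ j, Z i j • H i j) := by
  simp only [Matrix.add_apply, mul_add, Finset.sum_add_distrib, map_sum, map_smul, smul_eq_mul]
  congr 1
  simp [Matrix.one_apply, Matrix.trace]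

theorem isSymm_pencil (hH : ∀ i j, H i j = H j i) (ℓ : Module.Dual ℝ E) :
    (pencil H ℓ).IsSymm :=
  Matrix.IsSymm.ext fun i j => congrArg ℓ (hH j i)

theorem isSpectrahedron_pencilSet (hH : ∀ i j, H i j = H j i) : IsSpectrahedron (pencilSet H) :=
  ⟨N, 1, pencil H, Matrix.isSymm_one, isSymm_pencil hH, rfl⟩

/-- The linear images of the positive semidefinite matrices of trace at most one. -/
def momentBody (H : Fin N → Fin N → E) : Set E :=
  {y | ∃ Z : Matrix (Fin N) (Fin N) ℝ, Z.PosSemidef ∧ Z.trace ≤ 1 ∧ y = ∑ i, ∑ j, Z i j • H i j}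

theorem convex_momentBody (H : Fin N → Fin N → E) : Convex ℝ (momentBody H) := by
  rintro _ ⟨Z, hZ, hZt, rfl⟩ _ ⟨Z', hZ', hZt', rfl⟩ s t hs ht hst
  refine ⟨s • Z + t • Z', (hZ.smul hs).add (hZ'.smul ht), ?_, ?_⟩
  · rw [Matrix.trace_add, Matrix.trace_smul, Matrix.trace_smul, smul_eq_mul, smul_eq_mul]
    nlinarith
  · simp only [Finset.smul_sum, ← Finset.sum_add_distrib, Matrix.add_apply, Matrix.smul_apply,
      add_smul, smul_assoc]

/-- The trace pairing of two positive semidefinite matrices is nonnegative: it is the quadratic form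
of their Hadamard product at the all-ones vector. -/
theorem momentBody_subset_polar (H : Fin N → Fin N → E) :
    momentBody H ⊆ polar (pencilSet H) := by
  rintro _ ⟨Z, hZ, hZt, rfl⟩ ℓ hℓ
  have h := (posSemidef_iff_sum.1 (hZ.hadamard hℓ)).2 fun _ => 1
  simp only [one_mul, Matrix.hadamard_apply] at h
  rw [sum_one_add_pencil] at h
  linarith

/-- The auxiliary variable is an arbitrary matrix, symmetrized by `sym`. The equation for `y`
becomes two inequalities per coordinate, and the trace bound is one more. -/
theorem isSDR_momentBody [FiniteDimensional ℝ E] (H : Fin N → Fin N → E) : IsSDR (momentBody H) := by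
  let b := Module.finBasis ℝ E
  let sym : Matrix (Fin N) (Fin N) ℝ →ₗ[ℝ] Matrix (Fin N) (Fin N) ℝ :=
    LinearMap.id + (Matrix.transposeLinearEquiv (Fin N) (Fin N) ℝ ℝ).toLinearMap
  let comb : Matrix (Fin N) (Fin N) ℝ →ₗ[ℝ] E :=
    { toFun Z := ∑ i, ∑ j, Z i j • H i j
      map_add' X Y := by simp only [Matrix.add_apply, add_smul, Finset.sum_add_distrib]
      map_smul' r X := by
        simp only [Matrix.smul_apply, smul_assoc, Finset.smul_sum, RingHom.id_apply] }
  have hsymm : ∀ Y, (sym Y).IsSymm := fun Y => by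
    change (Y + Y.transpose).transpose = Y + Y.transpose
    rw [Matrix.transpose_add, Matrix.transpose_transpose, add_comm]
  let c := b.equivFun.toLinearMap
  let d := Fin (Module.finrank ℝ E)
  let β : E →ₗ[ℝ] (d ⊕ d) ⊕ Unit → ℝ := LinearMap.pi (Sum.elim
    (Sum.elim (fun i => LinearMap.proj i ∘ₗ c) fun i => -(LinearMap.proj i ∘ₗ c)) fun _ => 0)
  let γ : Matrix (Fin N) (Fin N) ℝ →ₗ[ℝ] (d ⊕ d) ⊕ Unit → ℝ := LinearMap.pi (Sum.elim
    (Sum.elim (fun i => -(LinearMap.proj i ∘ₗ c ∘ₗ comb ∘ₗ sym))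
      fun i => LinearMap.proj i ∘ₗ c ∘ₗ comb ∘ₗ sym)
    fun _ => -(Matrix.traceLinearMap (Fin N) ℝ ℝ ∘ₗ sym))
  have h := isSDR_of_affine sym hsymm (Sum.elim (fun _ => 0) fun _ => 1) β γ
  convert h using 1
  ext y
  have hcond : ∀ Y, (∀ i, 0 ≤ Sum.elim (fun _ => (0 : ℝ)) (fun _ => 1) i + β y i + γ Y i) ↔
      (sym Y).trace ≤ 1 ∧ y = comb (sym Y) := by
    intro Y
    simp only [Sum.forall, Sum.elim_inl, Sum.elim_inr, β, γ, LinearMap.pi_apply,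
      LinearMap.neg_apply, LinearMap.comp_apply, LinearMap.zero_apply, LinearMap.proj_apply,
      Matrix.traceLinearMap_apply]
    constructor
    · rintro ⟨⟨h₁, h₂⟩, h₃⟩
      refine ⟨by linarith [h₃ ()], b.equivFun.injective (funext fun i => ?_)⟩
      change c y i = c (comb (sym Y)) i
      have h₁ := h₁ i
      have h₂ := h₂ i
      exact le_antisymm (by linarith) (by linarith)
    · rintro ⟨h₁, h₂⟩
      rw [← h₂]
      refine ⟨⟨fun i => by simp, fun i => by simp⟩, fun _ => by linarith⟩
  constructor
  · rintro ⟨Z, hZ, hZt, rfl⟩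
    -- `sym` doubles symmetric matrices, hence the factor one half.
    have hs : sym ((1 / 2 : ℝ) • Z) = Z := by
      have : Z.transpose = Z := (posSemidef_iff_sum.1 hZ).1
      change (1 / 2 : ℝ) • Z + ((1 / 2 : ℝ) • Z).transpose = Z
      rw [Matrix.transpose_smul, this, ← add_smul]
      norm_num
    refine ⟨(1 / 2 : ℝ) • Z, by rwa [hs], (hcond _).2 ?_⟩
    rw [hs]
    exact ⟨hZt, rfl⟩
  · rintro ⟨Y, hY, hY'⟩
    obtain ⟨h₁, h₂⟩ := (hcond Y).1 hY'
    exact ⟨sym Y, hY, h₁, h₂⟩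

variable [FiniteDimensional ℝ E] [TopologicalSpace E] [IsModuleTopology ℝ E]

/-- The hull of the images `q c` of rank-one matrices, `c` in the unit ball, is compact and lies in
`momentBody H`. A functional separating `y` from it satisfies `|c|² + ℓ(q c) ≥ 0` for all `c` by
homogeneity, so it belongs to `pencilSet H` and contradicts `y ∈ polar`. -/
theorem polar_subset_momentBody (hH : ∀ i j, H i j = H j i) :
    polar (pencilSet H) ⊆ momentBody H := by
  have := IsModuleTopology.topologicalAddGroup ℝ E
  have := t2Space_of_isModuleTopology E
  let q : (Fin N → ℝ) → E := fun c => ∑ i, ∑ j, (c i * c j) • H i j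
  have hq : Continuous q := by fun_prop
  let S : Set (Fin N → ℝ) := {c | ∑ i, c i * c i ≤ 1}
  have hS : IsCompact S := by
    refine (isCompact_univ_pi fun _ : Fin N =>
      isCompact_Icc (a := (-1 : ℝ)) (b := 1)).of_isClosed_subset
      (isClosed_le (by fun_prop) continuous_const) fun c hc i _ => ?_
    have h1 : c i * c i ≤ 1 :=
      (Finset.single_le_sum (f := fun i => c i * c i) (fun i _ => mul_self_nonneg _)
        (Finset.mem_univ i)).trans hc
    exact ⟨by nlinarith, by nlinarith⟩
  have hK : IsCompact (convexHull ℝ (q '' S)) := isCompact_convexHull_of_isCompact (hS.image hq)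
  have hsub : convexHull ℝ (q '' S) ⊆ momentBody H := by
    refine convexHull_min ?_ (convex_momentBody H)
    rintro _ ⟨c, hc, rfl⟩
    exact ⟨Matrix.vecMulVec c c, Matrix.posSemidef_vecMulVec_self_star c, hc, rfl⟩
  have h0 : (0 : E) ∈ convexHull ℝ (q '' S) :=
    subset_convexHull ℝ _ ⟨0, by simp [S], by simp [q]⟩
  intro y hy
  refine hsub ?_
  by_contra hyK
  obtain ⟨ℓ, hℓ, hℓK⟩ := exists_dual_lt (convex_convexHull ℝ _) hK.isClosed h0 hyK
  refine absurd (hy ℓ ?_) (not_le.2 hℓ)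
  refine posSemidef_iff_sum.2 ⟨Matrix.isSymm_one.add (isSymm_pencil hH ℓ), fun c => ?_⟩
  have hc := sum_one_add_pencil H ℓ (Matrix.vecMulVec c c)
  simp only [Matrix.vecMulVec_apply] at hc
  rw [hc]
  change 0 ≤ ∑ i, c i * c i + ℓ (q c)
  set s := ∑ i, c i * c i with hs
  have hs0 : 0 ≤ s := Finset.sum_nonneg fun i _ => mul_self_nonneg _
  rcases hs0.eq_or_lt with h | h
  · have hc0 : c = 0 := by
      funext i
      exact mul_self_eq_zero.1
        ((Finset.sum_eq_zero_iff_of_nonneg fun i _ => mul_self_nonneg (c i)).1 h.symm i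
          (Finset.mem_univ i))
    simp [hc0, q, ← h]
  -- Normalize `c` to unit length and use that `q` is quadratic.
  · have hr : (Real.sqrt s)⁻¹ * (Real.sqrt s)⁻¹ = s⁻¹ := by
      rw [← mul_inv, Real.mul_self_sqrt hs0]
    have hmem : (Real.sqrt s)⁻¹ • c ∈ S := by
      have : ∑ i, ((Real.sqrt s)⁻¹ • c) i * ((Real.sqrt s)⁻¹ • c) i = s⁻¹ * s := by
        rw [hs, Finset.mul_sum, ← hs]
        refine Finset.sum_congr rfl fun i _ => ?_
        rw [Pi.smul_apply, smul_eq_mul, mul_mul_mul_comm, hr]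
      change ∑ i, ((Real.sqrt s)⁻¹ • c) i * ((Real.sqrt s)⁻¹ • c) i ≤ 1
      rw [this, inv_mul_cancel₀ h.ne']
    have hqs : q ((Real.sqrt s)⁻¹ • c) = s⁻¹ • q c := by
      simp only [q, Pi.smul_apply, smul_eq_mul, Finset.smul_sum, smul_smul]
      refine Finset.sum_congr rfl fun i _ => Finset.sum_congr rfl fun j _ => ?_
      rw [mul_mul_mul_comm, hr]
    have := hℓK _ (subset_convexHull ℝ _ ⟨_, hmem, rfl⟩)
    rw [hqs, map_smul, smul_eq_mul, le_inv_mul_iff₀ h] at this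
    linarith

theorem isSDR_polar_pencilSet (hH : ∀ i j, H i j = H j i) : IsSDR (polar (pencilSet H)) := by
  rw [(polar_subset_momentBody hH).antisymm (momentBody_subset_polar H)]
  exact isSDR_momentBody H

end Polar

theorem convex_polar {E : Type*} [AddCommGroup E] [Module ℝ E] (Q : Set (Module.Dual ℝ E)) :
    Convex ℝ (polar Q) := by
  intro x hx y hy s t hs ht hst ℓ hℓ
  rw [map_add, map_smul, map_smul, smul_eq_mul, smul_eq_mul]
  have := hx ℓ hℓ
  have := hy ℓ hℓ
  nlinarith

/-! ### Polynomials on products of a compact set -/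

section Moments

variable (μ : YoungDiagram) {V : Type u} [AddCommGroup V] [Module ℝ V] [FiniteDimensional ℝ V]

/-- Polynomials in the coordinates of the vectors in the boxes. -/
abbrev BoxPoly (μ : YoungDiagram) (V : Type u) [AddCommGroup V] [Module ℝ V] : Type :=
  MvPolynomial (Box μ × Fin (Module.finrank ℝ V)) ℝ

theorem evalPoly_add (a b : BoxPoly μ V) (x : Box μ → V) :
    evalPoly μ (a + b) x = evalPoly μ a x + evalPoly μ b x := by
  simp [evalPoly]

theorem evalPoly_smul (r : ℝ) (a : BoxPoly μ V) (x : Box μ → V) :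
    evalPoly μ (r • a) x = r * evalPoly μ a x := by
  simp [evalPoly]

theorem evalPoly_sum {ι : Type*} (s : Finset ι) (a : ι → BoxPoly μ V) (x : Box μ → V) :
    evalPoly μ (∑ i ∈ s, a i) x = ∑ i ∈ s, evalPoly μ (a i) x := by
  simp [evalPoly]

/-- The product measure restricted to `P × ⋯ × P`. -/
noncomputable abbrev boxMeasure {V : Type u} [MeasurableSpace V] (P : Set V) (ν : Measure V) : Measure (Box μ → V) :=
  (Measure.pi fun _ : Box μ => ν).restrict (Set.univ.pi fun _ : Box μ => P)

/-- The product measure already lives on the product of copies of `P`, so restricting changes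
nothing. A neighbourhood contains a product of neighbourhoods, whose measure is a product of
positive numbers. -/
theorem boxMeasure_pos {V : Type u} [TopologicalSpace V] [MeasurableSpace V] {P : Set V}
    {ν : Measure V} (hν : IsSupportedOn ν P) {x : Box μ → V} (hx : ∀ c, x c ∈ P)
    {U : Set (Box μ → V)} (hU : U ∈ 𝓝 x) : 0 < boxMeasure μ P ν U := by
  have := hν.finite
  have hae : ∀ᵐ y ∂(Measure.pi fun _ : Box μ => ν), y ∈ Set.univ.pi fun _ : Box μ => P := by
    have : ∀ᵐ y ∂(Measure.pi fun _ : Box μ => ν), ∀ c, y c ∈ P :=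
      ae_all_iff.2 fun c =>
        Measure.pi_eval_preimage_null (fun _ : Box μ => ν) (i := c) (s := Pᶜ) hν.compl_eq_zero
    filter_upwards [this] with y hy c _ using hy c
  rw [boxMeasure, Measure.restrict_eq_self_of_ae_mem hae]
  rw [nhds_pi, Filter.mem_pi] at hU
  obtain ⟨I, -, t, ht, hsub⟩ := hU
  refine lt_of_lt_of_le ?_ (measure_mono fun y (hy : y ∈ Set.univ.pi t) =>
    hsub fun c _ => hy c trivial)
  rw [Measure.pi_pi, pos_iff_ne_zero, Finset.prod_ne_zero_iff]
  exact fun c _ => (hν.pos _ (hx c) _ (ht c)).ne'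

theorem momentForm_eq [MeasurableSpace V] (P : Set V) (ν : Measure V) (ℓ : Module.Dual ℝ (SchurModule μ V))
    (a b : BoxPoly μ V) : momentForm μ P ν ℓ a b =
      ∫ x, (1 + ℓ (schurH μ V x)) * evalPoly μ a x * evalPoly μ b x ∂boxMeasure μ P ν := rfl

theorem antitone_schemeQ [MeasurableSpace V] (P : Set V) (ν : Measure V) : Antitone (schemeQ μ P ν) :=
  fun _ _ h _ hℓ a ha => hℓ a (ha.trans h)

variable [TopologicalSpace V] [IsModuleTopology ℝ V]

theorem continuous_boxCoord (t : Box μ × Fin (Module.finrank ℝ V)) :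
    Continuous fun x : Box μ → V => (Module.finBasis ℝ V).repr (x t.1) t.2 :=
  (IsModuleTopology.continuous_of_linearMap ((Module.finBasis ℝ V).coord t.2)).comp
    (continuous_apply t.1)

theorem continuous_evalPoly (a : BoxPoly μ V) : Continuous (evalPoly μ a) :=
  (MvPolynomial.continuous_eval a).comp (continuous_pi (continuous_boxCoord μ))

theorem continuous_dual_schurH (ℓ : Module.Dual ℝ (SchurModule μ V)) :
    Continuous fun x => ℓ (schurH μ V x) :=
  (IsModuleTopology.continuous_of_linearMap ℓ).comp (continuous_multilinearMap _)

/-- Polynomials are dense in the continuous functions on a compact set. -/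
theorem exists_evalPoly_near {K : Set (Box μ → V)} (hK : IsCompact K) {φ : (Box μ → V) → ℝ}
    (hφ : Continuous φ) {ε : ℝ} (hε : 0 < ε) :
    ∃ a : BoxPoly μ V, ∀ x ∈ K, |evalPoly μ a x - φ x| < ε := by
  have : CompactSpace K := isCompact_iff_compactSpace.1 hK
  let coord : Box μ × Fin (Module.finrank ℝ V) → C(K, ℝ) := fun t =>
    ⟨fun x => (Module.finBasis ℝ V).repr (x.1 t.1) t.2,
      (continuous_boxCoord μ t).comp continuous_subtype_val⟩
  let A : Subalgebra ℝ C(K, ℝ) := (MvPolynomial.aeval coord).range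
  have hsep : A.SeparatesPoints := by
    intro x y hxy
    obtain ⟨c, hc⟩ := Function.ne_iff.1 (Subtype.coe_injective.ne hxy)
    have : (Module.finBasis ℝ V).repr (x.1 c) ≠ (Module.finBasis ℝ V).repr (y.1 c) :=
      (Module.finBasis ℝ V).repr.injective.ne hc
    obtain ⟨i, hi⟩ := DFunLike.ne_iff.1 this
    exact ⟨_, ⟨coord (c, i), ⟨MvPolynomial.X (c, i), by simp⟩, rfl⟩, hi⟩
  have htop := ContinuousMap.subalgebra_topologicalClosure_eq_top_of_separatesPoints A hsep
  have hmem : (⟨fun x => φ x.1, hφ.comp continuous_subtype_val⟩ : C(K, ℝ)) ∈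
      A.topologicalClosure := by
    rw [htop]
    trivial
  obtain ⟨g, ⟨a, rfl⟩, hg⟩ := Metric.mem_closure_iff.1 hmem ε hε
  refine ⟨a, fun x hx => ?_⟩
  have h := (ContinuousMap.dist_lt_iff hε).1 hg ⟨x, hx⟩
  have heval : (MvPolynomial.aeval coord a) ⟨x, hx⟩ = evalPoly μ a x := by
    refine (MvPolynomial.comp_aeval_apply coord
      (ContinuousMap.evalAlgHom ℝ ℝ (⟨x, hx⟩ : K)) a).trans ?_
    rw [MvPolynomial.aeval_eq_eval]
    rfl
  rw [dist_comm, Real.dist_eq] at h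
  rw [← heval]
  exact h

variable [MeasurableSpace V] [BorelSpace V] {P : Set V} {ν : Measure V}

theorem borelSpace_box (μ : YoungDiagram) (V : Type u) [AddCommGroup V] [Module ℝ V]
    [FiniteDimensional ℝ V] [TopologicalSpace V] [IsModuleTopology ℝ V] [MeasurableSpace V]
    [BorelSpace V] : BorelSpace (Box μ → V) := by
  have := secondCountable_of_isModuleTopology V
  infer_instance

theorem integrable_boxMeasure [IsFiniteMeasure ν] (hP : IsCompact P) {F : (Box μ → V) → ℝ}
    (hF : Continuous F) : Integrable F (boxMeasure μ P ν) := by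
  have := borelSpace_box μ V
  have := t2Space_of_isModuleTopology V
  exact hF.continuousOn.integrableOn_compact (isCompact_univ_pi fun _ => hP)

theorem ae_mem_box (hP : IsCompact P) :
    ∀ᵐ x ∂boxMeasure μ P ν, x ∈ Set.univ.pi fun _ : Box μ => P := by
  have := borelSpace_box μ V
  have := t2Space_of_isModuleTopology V
  exact ae_restrict_mem (isCompact_univ_pi fun _ => hP).measurableSet

/-- A continuous function whose integral against all squares of polynomials is nonnegative is
nonnegative on the support of the measure. -/
theorem nonneg_of_integral_sq_nonneg (hP : IsCompact P) (hν : IsSupportedOn ν P)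
    {f : (Box μ → V) → ℝ} (hf : Continuous f)
    (h : ∀ a : BoxPoly μ V, 0 ≤ ∫ x, f x * evalPoly μ a x * evalPoly μ a x ∂boxMeasure μ P ν)
    {x : Box μ → V} (hx : ∀ c, x c ∈ P) : 0 ≤ f x := by
  have := hν.finite
  -- `φ` is the square root of the negative part of `f`, so `f φ² = -(f⁻)²`. Approximating `φ` by
  -- polynomials gives `∫ f φ² ≥ 0`, hence `f⁻ = 0` almost everywhere.
  let φ : (Box μ → V) → ℝ := fun x => Real.sqrt (max (-f x) 0)
  have hφ : Continuous φ := by fun_prop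
  have hφsq : ∀ x, φ x * φ x = max (-f x) 0 := fun x => Real.mul_self_sqrt (le_max_right _ _)
  have hK : IsCompact (Set.univ.pi fun _ : Box μ => P) := isCompact_univ_pi fun _ => hP
  obtain ⟨C₁, hC₁⟩ := hK.exists_bound_of_continuousOn hf.continuousOn
  obtain ⟨C₂, hC₂⟩ := hK.exists_bound_of_continuousOn hφ.continuousOn
  have hC₁0 : 0 ≤ C₁ := (norm_nonneg _).trans (hC₁ x fun c _ => hx c)
  have hC₂0 : 0 ≤ C₂ := (norm_nonneg _).trans (hC₂ x fun c _ => hx c)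
  -- From `|p² - φ²| = |p + φ| |p - φ| ≤ (2 C₂ + 1) ε` when `|p - φ| ≤ ε ≤ 1`.
  set D := C₁ * (2 * C₂ + 1) with hD
  have hlow : ∀ ε : ℝ, 0 < ε → ε ≤ 1 →
      -(D * (boxMeasure μ P ν).real Set.univ) * ε ≤ ∫ x, f x * φ x * φ x ∂boxMeasure μ P ν := by
    intro ε hε hε1
    obtain ⟨a, ha⟩ := exists_evalPoly_near μ hK hφ hε
    have hint : Integrable (fun x => f x * evalPoly μ a x * evalPoly μ a x) (boxMeasure μ P ν) :=
      integrable_boxMeasure μ hP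
        ((hf.mul (continuous_evalPoly μ a)).mul (continuous_evalPoly μ a))
    have hmono : ∫ x, (f x * evalPoly μ a x * evalPoly μ a x - D * ε) ∂boxMeasure μ P ν ≤
        ∫ x, f x * φ x * φ x ∂boxMeasure μ P ν := by
      refine integral_mono_ae (hint.sub (integrable_const _))
        (integrable_boxMeasure μ hP ((hf.mul hφ).mul hφ)) ?_
      filter_upwards [ae_mem_box μ hP] with y hy
      have h1 : |f y| ≤ C₁ := hC₁ y hy
      have h2 : |φ y| ≤ C₂ := hC₂ y hy
      have h3 := (ha y hy).le
      set p := evalPoly μ a y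
      have h4 : |p + φ y| ≤ 2 * C₂ + 1 := by
        calc |p + φ y| = |(p - φ y) + 2 * φ y| := by ring_nf
          _ ≤ |p - φ y| + |2 * φ y| := abs_add_le _ _
          _ = |p - φ y| + 2 * |φ y| := by rw [abs_mul, abs_two]
          _ ≤ 2 * C₂ + 1 := by linarith
      have h5 : |f y * ((p + φ y) * (p - φ y))| ≤ D * ε := by
        rw [abs_mul, abs_mul, hD, mul_assoc]
        gcongr
      have h6 := (abs_le.1 h5).2
      have h7 : f y * ((p + φ y) * (p - φ y)) = f y * p * p - f y * φ y * φ y := by ring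
      linarith
    rw [integral_sub hint (integrable_const _), integral_const, smul_eq_mul] at hmono
    have := h a
    linarith
  have hI : 0 ≤ ∫ x, f x * φ x * φ x ∂boxMeasure μ P ν := by
    have htend : Filter.Tendsto (fun n : ℕ => -(D * (boxMeasure μ P ν).real Set.univ) *
        (1 / ((n : ℝ) + 1))) Filter.atTop (𝓝 0) := by
      simpa using tendsto_one_div_add_atTop_nhds_zero_nat.const_mul
        (-(D * (boxMeasure μ P ν).real Set.univ))
    refine le_of_tendsto' htend fun n => hlow _ Nat.one_div_pos_of_nat ?_
    rw [div_le_one (by positivity)]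
    linarith [(Nat.cast_nonneg n : (0 : ℝ) ≤ n)]
  have hneg : ∀ y, f y * φ y * φ y = -(max (-f y) 0 * max (-f y) 0) := by
    intro y
    rw [mul_assoc, hφsq]
    rcases le_total (-f y) 0 with h | h
    · simp [max_eq_right h]
    · rw [max_eq_left h]
      ring
  simp only [hneg, integral_neg] at hI
  have hcont : Continuous fun y => max (-f y) 0 * max (-f y) 0 := by fun_prop
  have hzero : ∫ y, max (-f y) 0 * max (-f y) 0 ∂boxMeasure μ P ν = 0 :=
    le_antisymm (by linarith) (integral_nonneg fun y => mul_self_nonneg _)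
  rw [integral_eq_zero_iff_of_nonneg (fun y => mul_self_nonneg _)
    (integrable_boxMeasure μ hP hcont)] at hzero
  by_contra! hlt
  have hU : {y | f y < 0} ∈ 𝓝 x := (isOpen_lt hf continuous_const).mem_nhds hlt
  refine (boxMeasure_pos μ hν hx hU).ne' (measure_mono_null (fun y hy => ?_) hzero)
  have hy' : 0 < -f y := neg_pos.2 hy
  intro h0
  have : max (-f y) 0 * max (-f y) 0 = 0 := h0
  rw [max_eq_left hy'.le] at this
  exact hy'.ne' (mul_self_eq_zero.1 this)

/-- The vector-valued moment `∫ h(x) g(x)`, described by its pairings with functionals. -/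
noncomputable def moment (P : Set V) (ν : Measure V) (g : (Box μ → V) → ℝ) : SchurModule μ V :=
  ∑ s, (∫ x, (Module.finBasis ℝ (SchurModule μ V)).coord s (schurH μ V x) * g x
    ∂boxMeasure μ P ν) • Module.finBasis ℝ (SchurModule μ V) s

theorem dual_moment [IsFiniteMeasure ν] (hP : IsCompact P) {g : (Box μ → V) → ℝ}
    (hg : Continuous g) (ℓ : Module.Dual ℝ (SchurModule μ V)) :
    ℓ (moment μ P ν g) = ∫ x, ℓ (schurH μ V x) * g x ∂boxMeasure μ P ν := by
  set b := Module.finBasis ℝ (SchurModule μ V) with hb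
  have hexp : ∀ x, ℓ (schurH μ V x) * g x =
      ∑ s, ℓ (b s) * (b.coord s (schurH μ V x) * g x) := by
    intro x
    conv_lhs => rw [← b.sum_repr (schurH μ V x)]
    simp only [map_sum, map_smul, smul_eq_mul, Finset.sum_mul, Module.Basis.coord_apply]
    exact Finset.sum_congr rfl fun s _ => by ring
  simp only [hexp]
  have hint : ∀ s, Integrable (fun x => ℓ (b s) * (b.coord s (schurH μ V x) * g x))
      (boxMeasure μ P ν) := fun s => (integrable_boxMeasure μ hP
    ((continuous_dual_schurH μ (b.coord s)).mul hg)).const_mul _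
  rw [integral_finsetSum _ fun s _ => hint s]
  simp only [integral_const_mul, moment, map_sum, map_smul, smul_eq_mul]
  exact Finset.sum_congr rfl fun s _ => mul_comm _ _

/-- Polynomials of degree at most `k` have a finite orthonormal spanning set, up to null
functions. -/
theorem exists_orthonormal_polynomials [IsFiniteMeasure ν] (hP : IsCompact P) (k : ℕ) :
    ∃ (N : ℕ) (p : Fin N → BoxPoly μ V), (∀ i, (p i).totalDegree ≤ k) ∧
      (∀ i j, ∫ x, evalPoly μ (p i) x * evalPoly μ (p j) x ∂boxMeasure μ P ν =
        (1 : Matrix (Fin N) (Fin N) ℝ) i j) ∧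
      ∀ a : BoxPoly μ V, a.totalDegree ≤ k → ∃ c : Fin N → ℝ,
        evalPoly μ a =ᵐ[boxMeasure μ P ν] evalPoly μ (∑ i, c i • p i) := by
  have := borelSpace_box μ V
  have hL2 : ∀ a : BoxPoly μ V, MemLp (evalPoly μ a) 2 (boxMeasure μ P ν) := fun a =>
    (memLp_two_iff_integrable_sq (continuous_evalPoly μ a).aestronglyMeasurable).2
      (integrable_boxMeasure μ hP ((continuous_evalPoly μ a).pow 2))
  -- Distinct polynomials may agree almost everywhere, so the orthonormal basis is taken in the
  -- image of the degree-`k` polynomials in `L²` and then lifted.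
  let J : BoxPoly μ V →ₗ[ℝ] Lp ℝ 2 (boxMeasure μ P ν) :=
    { toFun a := (hL2 a).toLp
      map_add' a b := by
        rw [← MemLp.toLp_add]
        exact MemLp.toLp_congr _ _ (Filter.Eventually.of_forall fun x => evalPoly_add μ a b x)
      map_smul' r a := by
        rw [RingHom.id_apply, ← MemLp.toLp_const_smul]
        exact MemLp.toLp_congr _ _ (Filter.Eventually.of_forall fun x => evalPoly_smul μ r a x) }
  let S := (MvPolynomial.restrictTotalDegree (Box μ × Fin (Module.finrank ℝ V)) ℝ k).map J
  let b := stdOrthonormalBasis ℝ S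
  have hb : ∀ i, ∃ a : BoxPoly μ V, a.totalDegree ≤ k ∧ J a = b i := fun i => by
    obtain ⟨a, ha, hJ⟩ := (b i).2
    exact ⟨a, (MvPolynomial.mem_restrictTotalDegree _ _ _).1 ha, hJ⟩
  choose p hp hJp using hb
  refine ⟨_, p, hp, fun i j => ?_, fun a ha => ?_⟩
  · have h := (orthonormal_iff_ite.1 b.orthonormal) i j
    rw [Submodule.coe_inner, ← hJp, ← hJp, L2.inner_def] at h
    rw [Matrix.one_apply, ← h]
    refine integral_congr_ae ?_
    filter_upwards [(hL2 (p i)).coeFn_toLp, (hL2 (p j)).coeFn_toLp] with x hi hj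
    change _ = inner ℝ ((hL2 (p i)).toLp (evalPoly μ (p i)) x)
      ((hL2 (p j)).toLp (evalPoly μ (p j)) x)
    rw [hi, hj]
    simp [mul_comm]
  · have haS : J a ∈ S := ⟨a, (MvPolynomial.mem_restrictTotalDegree _ _ _).2 ha, rfl⟩
    refine ⟨fun i => b.repr ⟨J a, haS⟩ i, ?_⟩
    have hsum : J a = J (∑ i, b.repr ⟨J a, haS⟩ i • p i) := by
      rw [map_sum]
      simp only [map_smul, hJp]
      have := congrArg (Subtype.val) (b.sum_repr ⟨J a, haS⟩)
      simpa using this.symm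
    exact (hL2 a).coeFn_toLp.symm.trans ((by rw [show (hL2 a).toLp = _ from hsum]; rfl :
      ((hL2 a).toLp : (Box μ → V) → ℝ) =ᵐ[boxMeasure μ P ν] _).trans (hL2 _).coeFn_toLp)

theorem momentForm_split [IsFiniteMeasure ν] (hP : IsCompact P)
    (ℓ : Module.Dual ℝ (SchurModule μ V)) (a b : BoxPoly μ V) :
    momentForm μ P ν ℓ a b = ∫ x, evalPoly μ a x * evalPoly μ b x ∂boxMeasure μ P ν +
      ℓ (moment μ P ν fun x => evalPoly μ a x * evalPoly μ b x) := by
  have hab : Continuous fun x => evalPoly μ a x * evalPoly μ b x :=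
    (continuous_evalPoly μ a).mul (continuous_evalPoly μ b)
  have hℓ : Integrable (fun x => ℓ (schurH μ V x) * (evalPoly μ a x * evalPoly μ b x))
      (boxMeasure μ P ν) := integrable_boxMeasure μ hP ((continuous_dual_schurH μ ℓ).mul hab)
  rw [dual_moment μ hP hab, momentForm_eq, ← integral_add (integrable_boxMeasure μ hP hab) hℓ]
  exact integral_congr_ae (Filter.Eventually.of_forall fun x => by ring)

theorem momentForm_sum [IsFiniteMeasure ν] (hP : IsCompact P)
    (ℓ : Module.Dual ℝ (SchurModule μ V)) {N : ℕ} (p : Fin N → BoxPoly μ V) (c : Fin N → ℝ) :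
    momentForm μ P ν ℓ (∑ i, c i • p i) (∑ i, c i • p i) =
      ∑ i, ∑ j, c i * c j * momentForm μ P ν ℓ (p i) (p j) := by
  have hint : ∀ i j, Integrable (fun x => c i * c j *
      ((1 + ℓ (schurH μ V x)) * evalPoly μ (p i) x * evalPoly μ (p j) x)) (boxMeasure μ P ν) :=
    fun i j => (integrable_boxMeasure μ hP (((continuous_const.add
      (continuous_dual_schurH μ ℓ)).mul (continuous_evalPoly μ _)).mul
        (continuous_evalPoly μ _))).const_mul _
  simp only [momentForm_eq, ← integral_const_mul]
  simp only [← integral_finsetSum _ fun j _ => hint _ j]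
  rw [← integral_finsetSum _ fun i _ => integrable_finsetSum _ fun j _ => hint i j]
  refine integral_congr_ae (Filter.Eventually.of_forall fun x => ?_)
  simp only [evalPoly_sum, evalPoly_smul]
  rw [mul_assoc, Finset.sum_mul_sum, Finset.mul_sum]
  refine Finset.sum_congr rfl fun i _ => ?_
  rw [Finset.mul_sum]
  exact Finset.sum_congr rfl fun j _ => by ring

/-- The set `Q_k` is given by a linear matrix inequality with constant term the identity. -/
theorem exists_schemeQ_eq_pencilSet [IsFiniteMeasure ν] (hP : IsCompact P) (k : ℕ) :
    ∃ (N : ℕ) (H : Fin N → Fin N → SchurModule μ V), (∀ i j, H i j = H j i) ∧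
      schemeQ μ P ν k = pencilSet H := by
  obtain ⟨N, p, hp, hortho, hspan⟩ := exists_orthonormal_polynomials μ (ν := ν) hP k
  let H : Fin N → Fin N → SchurModule μ V := fun i j =>
    moment μ P ν fun x => evalPoly μ (p i) x * evalPoly μ (p j) x
  have hH : ∀ i j, H i j = H j i := fun i j => by simp only [H, mul_comm]
  have hentry : ∀ ℓ i j, momentForm μ P ν ℓ (p i) (p j) = (1 + pencil H ℓ) i j := fun ℓ i j => by
    rw [momentForm_split μ hP, hortho]
    rfl
  have hdeg : ∀ c : Fin N → ℝ, (∑ i, c i • p i).totalDegree ≤ k := fun c =>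
    (MvPolynomial.totalDegree_finsetSum_le fun i _ =>
      (MvPolynomial.totalDegree_smul_le _ _).trans (hp i))
  refine ⟨N, H, hH, Set.ext fun ℓ => ⟨fun hℓ => ?_, fun hℓ a ha => ?_⟩⟩
  · refine posSemidef_iff_sum.2
      ⟨Matrix.isSymm_one.add (isSymm_pencil hH ℓ), fun c => ?_⟩
    have := hℓ _ (hdeg c)
    rw [momentForm_sum μ hP] at this
    simpa only [hentry] using this
  · obtain ⟨c, hc⟩ := hspan a ha
    have : momentForm μ P ν ℓ a a = momentForm μ P ν ℓ (∑ i, c i • p i) (∑ i, c i • p i) := by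
      refine integral_congr_ae ?_
      filter_upwards [hc] with x hx
      rw [hx]
    rw [this, momentForm_sum μ hP]
    simp only [hentry]
    exact (posSemidef_iff_sum.1 hℓ).2 c

/-- Functionals bounded below by `-1` on `𝕊_μ(P)` belong to every `Q_k`. -/
theorem mem_schemeQ_of_schurSet (hP : IsCompact P) {ℓ : Module.Dual ℝ (SchurModule μ V)}
    (h : ∀ y ∈ schurSet μ P, -1 ≤ ℓ y) (k : ℕ) : ℓ ∈ schemeQ μ P ν k := by
  intro a _
  rw [momentForm_eq]
  refine integral_nonneg_of_ae ?_
  filter_upwards [ae_mem_box μ hP] with x hx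
  have := h _ (subset_convexHull ℝ _ ⟨x, hx, rfl⟩)
  rw [Pi.zero_apply, mul_assoc]
  exact mul_nonneg (by linarith) (mul_self_nonneg _)

/-- The sets `Q_k` are determined by their polars. -/
theorem mem_schemeQ_of_polar [IsFiniteMeasure ν] (hP : IsCompact P)
    {ℓ : Module.Dual ℝ (SchurModule μ V)} {k : ℕ}
    (h : ∀ y ∈ polar (schemeQ μ P ν k), -1 ≤ ℓ y) : ℓ ∈ schemeQ μ P ν k := by
  intro a ha
  set I := ∫ x, evalPoly μ a x * evalPoly μ a x ∂boxMeasure μ P ν with hI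
  have hI0 : 0 ≤ I := integral_nonneg fun x => mul_self_nonneg _
  have hcont : Continuous fun x => evalPoly μ a x * evalPoly μ a x :=
    (continuous_evalPoly μ a).mul (continuous_evalPoly μ a)
  -- If `I = 0`, then `a` vanishes almost everywhere and so does its form. Otherwise the normalized
  -- moment `I⁻¹ • m` lies in the polar, and evaluating `ℓ` there is the required inequality.
  rcases hI0.eq_or_lt with h0 | h0
  · rw [hI, eq_comm, integral_eq_zero_iff_of_nonneg (fun x => mul_self_nonneg _)
      (integrable_boxMeasure μ hP hcont)] at h0
    rw [momentForm_eq, integral_eq_zero_of_ae]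
    filter_upwards [h0] with x hx
    have hx' : evalPoly μ a x * evalPoly μ a x = 0 := hx
    rw [mul_assoc, hx', mul_zero]
    rfl
  · set m := moment μ P ν fun x => evalPoly μ a x * evalPoly μ a x
    have hpol : I⁻¹ • m ∈ polar (schemeQ μ P ν k) := by
      intro ℓ' hℓ'
      have := hℓ' a ha
      rw [momentForm_split μ hP] at this
      rw [map_smul, smul_eq_mul, le_inv_mul_iff₀ h0]
      linarith
    have := h _ hpol
    rw [map_smul, smul_eq_mul, le_inv_mul_iff₀ h0] at this
    rw [momentForm_split μ hP]
    linarith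

/-- Both inclusions are by separation. A functional separating a point of `schurSet μ P` from the
closed convex union is `≥ -1` on every polar, so it lies in every `Q_k`, and positivity on the
support gives a contradiction. Conversely, a functional separating a point from `schurSet μ P` lies
in each `Q_k`. -/
theorem isAccurateScheme (hμ : 0 < μ.card) (hP : IsCompactConvexZero P)
    (hν : IsSupportedOn ν P) : IsAccurateScheme μ P ν where
  antitone := antitone_schemeQ μ P ν
  spectrahedron k := by
    have := hν.finite
    obtain ⟨N, H, hH, h⟩ := exists_schemeQ_eq_pencilSet μ (ν := ν) hP.isCompact k
    rw [h]
    exact isSpectrahedron_pencilSet hH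
  sdr k := by
    have := hν.finite
    obtain ⟨N, H, hH, h⟩ := exists_schemeQ_eq_pencilSet μ (ν := ν) hP.isCompact k
    rw [h]
    exact isSDR_polar_pencilSet hH
  accurate := by
    have := hν.finite
    have := IsModuleTopology.topologicalAddGroup ℝ (SchurModule μ V)
    have := t2Space_of_isModuleTopology (SchurModule μ V)
    have hS := isCompactConvexZero_schurSet μ hμ hP
    refine Set.Subset.antisymm (fun s hs => ?_)
      (closure_minimal (Set.iUnion_subset fun k y hy => ?_) hS.isCompact.isClosed)
    · by_contra hsU
      have hmono : Monotone fun k => polar (schemeQ μ P ν k) := fun k l hkl y hy ℓ hℓ =>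
        hy ℓ (antitone_schemeQ μ P ν hkl hℓ)
      have hconv : Convex ℝ (closure (⋃ k, polar (schemeQ μ P ν k))) :=
        (hmono.directed_le.convex_iUnion fun k => convex_polar _).closure
      have h0 : (0 : SchurModule μ V) ∈ closure (⋃ k, polar (schemeQ μ P ν k)) :=
        subset_closure (Set.mem_iUnion.2 ⟨0, fun ℓ _ => by simp⟩)
      obtain ⟨ℓ, hℓs, hℓ⟩ := exists_dual_lt hconv isClosed_closure h0 hsU
      have hQ : ∀ k, ℓ ∈ schemeQ μ P ν k := fun k => mem_schemeQ_of_polar μ hP.isCompact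
        fun y hy => hℓ y (subset_closure (Set.mem_iUnion.2 ⟨k, hy⟩))
      have hpos : ∀ x : Box μ → V, (∀ c, x c ∈ P) → 0 ≤ 1 + ℓ (schurH μ V x) := fun x hx =>
        -- The level used for each test polynomial is its own degree.
        nonneg_of_integral_sq_nonneg μ hP.isCompact hν
          (continuous_const.add (continuous_dual_schurH μ ℓ)) (fun a => hQ _ a le_rfl) hx
      have : -1 ≤ ℓ s := by
        refine convexHull_min (t := {y | -1 ≤ ℓ y}) ?_ ?_ hs
        · rintro _ ⟨x, hx, rfl⟩
          have := hpos x fun c => hx c trivial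
          change -1 ≤ ℓ (schurH μ V x)
          linarith
        · exact convex_halfSpace_ge ℓ.isLinear _
      linarith
    · by_contra hyS
      obtain ⟨ℓ, hℓy, hℓ⟩ := exists_dual_lt hS.convex hS.isCompact.isClosed hS.zero_mem hyS
      have := hy ℓ (mem_schemeQ_of_schurSet μ hP.isCompact hℓ k)
      linarith

end Moments

/-- A convex body lies in the closure of its interior, so every neighbourhood of its points meets
that interior in a nonempty open set. -/
theorem isSupportedOn_restrict {V : Type u} [AddCommGroup V] [Module ℝ V] [FiniteDimensional ℝ V]
    [TopologicalSpace V] [IsModuleTopology ℝ V] [MeasurableSpace V] [BorelSpace V] {P : Set V}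
    (hP : IsConvexBody P) (vol : Measure V) [vol.IsAddHaarMeasure] :
    IsSupportedOn (vol.restrict P) P := by
  have := IsModuleTopology.topologicalAddGroup ℝ V
  have := t2Space_of_isModuleTopology V
  have hmeas : MeasurableSet P := hP.isCompact.measurableSet
  refine ⟨⟨by simpa using hP.isCompact.measure_lt_top⟩, by simp [hmeas], fun x hx U hU => ?_⟩
  rw [Measure.restrict_apply' hmeas]
  have hcl : x ∈ closure (interior P) := by
    rw [hP.convex.closure_interior_eq_closure_of_nonempty_interior hP.interior_nonempty]
    exact subset_closure hx
  have hne : (interior U ∩ interior P).Nonempty :=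
    mem_closure_iff_nhds.1 hcl _ (interior_mem_nhds.2 hU)
  exact ((isOpen_interior.inter isOpen_interior).measure_pos vol hne).trans_le
    (measure_mono (Set.inter_subset_inter interior_subset interior_subset))

end ConvexSchur

theorem mainTheorem8 (μ : YoungDiagram) (hμ : 0 < μ.card) :
    -- `𝕊_μ` is a functor on compact convex sets containing the origin
    (∃ (hS : ∀ P : CompactConvex.{u}, IsCompactConvexZero (schurSet μ P.carrier))
        (F : CompactConvex.{u} ⥤ CompactConvex.{u})
        (hobj : ∀ P, F.obj P = P.schurObj μ (hS P)),
        ∀ (P Q : CompactConvex.{u}) (f : P ⟶ Q) (L : P.space →ₗ[ℝ] Q.space),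
          CompactConvex.IsRestrictionOf f L →
          CompactConvex.IsRestrictionOf
            (eqToHom (hobj P).symm ≫ F.map f ≫ eqToHom (hobj Q)) (schurMap μ L)) ∧
    ∀ (V : Type u) [AddCommGroup V] [Module ℝ V] [FiniteDimensional ℝ V]
      [TopologicalSpace V] [IsModuleTopology ℝ V] [MeasurableSpace V] [BorelSpace V]
      (P : Set V), IsCompactConvexZero P →
      -- linearization of multilinear maps satisfying the exchange axioms
      (∀ (E : Type w) [AddCommGroup E] [Module ℝ E] [FiniteDimensional ℝ E]
        [TopologicalSpace E] [IsModuleTopology ℝ E] (W : Set E),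
        IsCompact W → Convex ℝ W → ∀ T : (Box μ → P) → W,
        (∃ M : MultilinearMap ℝ (fun _ : Box μ => V) E, ∀ p, (T p : E) = M fun c => (p c : V)) →
        ExchangeAxioms μ (fun p => (T p : E)) →
        ∃! t : schurSet μ P → W, IsLinearRestriction t ∧
          ∀ p : Box μ → P, t ⟨schurH μ V (fun c => (p c : V)), schurH_mem μ p⟩ = T p) ∧
      -- convex body, dimension, central symmetry
      (IsConvexBody P →
        IsConvexBody (schurSet μ P) ∧
        Module.finrank ℝ (vectorSpan ℝ (schurSet μ P)) =
          {T : SemistandardYoungTableau μ | ∀ i j, (i, j) ∈ μ →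
            T i j ∈ Finset.Icc 1 (Module.finrank ℝ V)}.ncard) ∧
      (1 < μ.colLen 0 → ∀ x ∈ schurSet μ P, -x ∈ schurSet μ P) ∧
      -- extreme points and polytopes
      schurSet μ P = convexHull ℝ (schurH μ V '' Set.univ.pi fun _ => P.extremePoints ℝ) ∧
      (IsPolytope P → IsPolytope (schurSet μ P)) ∧
      -- approximation by projections of spectrahedra
      (∀ ν : Measure V, IsSupportedOn ν P → IsAccurateScheme μ P ν) ∧
      (IsConvexBody P → ∀ vol : Measure V, vol.IsAddHaarMeasure →
        IsSupportedOn (vol.restrict P) P) := by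
  -- The objects agree by `rfl`, so the `eqToHom` morphisms are identities.
  refine ⟨⟨fun P => isCompactConvexZero_schurSet μ hμ P.isCompactConvexZero,
    CompactConvex.schurFunctor μ hμ, fun _ => rfl, fun P Q f L hL => ?_⟩, ?_⟩
  · exact CompactConvex.schurFunctor_isRestrictionOf μ hμ f L hL
  intro V _ _ _ _ _ _ _ P hP
  refine ⟨fun E _ _ _ _ _ W _ hW T hM hT => existsUnique_linearization μ hP.convex hW T hM hT,
    fun hb => ⟨isConvexBody_schurSet hμ hP hb, finrank_vectorSpan_schurSet hμ hP hb⟩,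
    fun h x hx => neg_mem_schurSet μ h hx, ?_, fun h => isPolytope_schurSet μ h,
    fun ν hν => isAccurateScheme μ hμ hP hν, fun hb vol _ => isSupportedOn_restrict hb vol⟩
  rw [← schurSet_convexHull, convexHull_extremePoints_eq hP.isCompact hP.convex]
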